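/- Let $N\ge 2$, let $[N]=\{0,\dots,N\}$, and let $V\cong\mathbb R^{1,N}$ be the real vector space with basis $\omega_0,\dots,\omega_N$ and the symmetric bilinear form of signature $(1,N)$ given by $\langle\omega_i,\omega_i\rangle=-(N-2)$ and $\langle\omega_i,\omega_j\rangle=1$ for $i\ne j$. Put $\alpha_i=\omega_0+\dots+\omega_N-2\omega_i$, let $\sigma_i(v)=v+\frac{\langle v,\alpha_i\rangle}{N-1}\alpha_i$ be the orthogonal reflection in $\alpha_i$, and let $W$ be the group generated by $\sigma_0,\dots,\sigma_N$ (it is isomorphic to $(\mathbb Z/2)^{*(N+1)}$). For $S\subseteq[N]$ let $W_S=\langle\sigma_s : s\in S\rangle$ and $\mathcal A_S=\{\sum_{s\in S}x_s\omega_s : x_s>0\}$, so that $\mathcal A_\emptyset=\{0\}$. Let $\overline{\mathcal T}$ be the closure of the Tits cone $\mathcal T=W\cdot\overline{\mathcal A_{[N]}}$, and $\partial\overline{\mathcal T}$ its boundary in $V$. Let $\mathcal H$ be the component of $\{v:\langle v,v\rangle>0\}$ that meets $\mathcal A_{[N]}$. Let $\Lambda_S\subset\mathbb P(V)$ be the limit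 set of $W_S$, i.e. the set of accumulation points of an orbit $W_S\cdot[v]$ with $v\in\mathcal H$ (it does not depend on $v$), and let $\widetilde\Lambda_S$ be the set of nonzero vectors of $\overline{\mathcal T}$ whose class in $\mathbb P(V)$ lies in $\Lambda_S$. A presentation of $p\in V$ consists of an element $w\in W$, disjoint subsets $S_d,S_r\subseteq[N]$, and vectors $q_d\in\mathcal A_{S_d}$ and $q_r$ such that $p=w\cdot q_d+w\cdot q_r$ and either $q_r\in\widetilde\Lambda_{S_r}$, or $S_r=\emptyset$ and $q_r=0$. A presentation of $p$ is called maximal if $|S_d|$ is maximal among all presentations of $p$ and, in case $|S_d|=N-1$, moreover $S_r=\emptyset$. Theorem. Every $p\in\partial\overline{\mathcal T}$ has a maximal presentation, and the vectors $p_d=w\cdot q_d$ and $p_r=w\cdot q_r$ are the same for all maximal presentations of $p$. Thus $p$ has a unique decomposition $p=p_d+p_r$ that comes from a maximal presentation. Furthermore $p_d,p_r\in\partial\overline{\mathcal T}$, and for every maximal presentation of $p$: if $S_r\ne\emptyset$ then $|S_r|\ge 3$, and if $S_d\neq\emptyset$ then $|S_d|\le N-1$. -/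

import Mathlib

open scoped LinearAlgebra.Projectivization

namespace Wehler

noncomputable section

/-- The real vector space with basis `ω₀, …, ω_N`; a vector is its family of coordinates in
that basis. -/
abbrev V (N : ℕ) : Type := Fin (N + 1) → ℝ

/-- The basis vector `ω_i`. -/
def omega (N : ℕ) (i : Fin (N + 1)) : V N := Pi.single i 1

/-- The symmetric bilinear form with `⟨ω_i, ω_i⟩ = -(N-2)` and `⟨ω_i, ω_j⟩ = 1` for `i ≠ j`. -/
def form (N : ℕ) : LinearMap.BilinForm ℝ (V N) :=
  Matrix.toBilin' (Matrix.of fun i j => if i = j then -((N : ℝ) - 2) else 1)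

/-- `u = ω₀ + ⋯ + ω_N`. -/
def uVec (N : ℕ) : V N := ∑ i, omega N i

/-- `α_i = u - 2 ω_i`. -/
def alpha (N : ℕ) (i : Fin (N + 1)) : V N := uVec N - (2 : ℝ) • omega N i

/-- The reflection `v ↦ v + ⟨v, α_i⟩ / (N - 1) • α_i`, as a linear map. -/
def sigmaLin (N : ℕ) (i : Fin (N + 1)) : V N →ₗ[ℝ] V N where
  toFun v := v + (form N v (alpha N i) / ((N : ℝ) - 1)) • alpha N i
  map_add' v w := by
    simp only [map_add, LinearMap.add_apply, add_div, add_smul]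
    abel
  map_smul' c v := by
    simp only [map_smul, LinearMap.smul_apply, smul_eq_mul, mul_div_assoc, smul_add, mul_smul,
      RingHom.id_apply]

theorem form_alpha_self (N : ℕ) (i : Fin (N + 1)) :
    form N (alpha N i) (alpha N i) = -2 * ((N : ℝ) - 1) := by
  have hu : ∀ k, uVec N k = 1 := by
    intro k
    simp [uVec, omega, Finset.sum_apply, Pi.single_apply]
  have hrow : ∀ k, ∑ j, (if k = j then -((N : ℝ) - 2) else 1) * alpha N i j
      = if k = i then 2 * ((N : ℝ) - 1) else 0 := by
    intro k
    have h1 : ∀ j, (if k = j then -((N : ℝ) - 2) else 1) * alpha N i j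
        = 1 - 2 * (if i = j then 1 else 0)
          - ((N : ℝ) - 1) * (if k = j then (1 - 2 * (if i = k then 1 else 0)) else 0) := by
      intro j
      simp only [alpha, Pi.sub_apply, Pi.smul_apply, hu, omega, Pi.single_apply, smul_eq_mul]
      by_cases hk : k = j <;> by_cases hi : i = j <;> grind
    rw [Finset.sum_congr rfl fun j _ => h1 j]
    simp only [Finset.sum_sub_distrib, ← Finset.mul_sum, Finset.sum_ite_eq, Finset.mem_univ,
      if_true, Finset.sum_const, Finset.card_univ, Fintype.card_fin, nsmul_eq_mul]
    push_cast
    by_cases hk : k = i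
    · simp [hk]; ring
    · have : i ≠ k := fun h => hk h.symm
      simp [hk, this]
      ring
  have : form N (alpha N i) (alpha N i)
      = ∑ k, alpha N i k * ∑ j, (if k = j then -((N : ℝ) - 2) else 1) * alpha N i j := by
    simp only [form, Matrix.toBilin'_apply, Matrix.of_apply, Finset.mul_sum, mul_assoc]
  rw [this]
  simp only [hrow]
  simp only [mul_ite, mul_zero, Finset.sum_ite_eq', Finset.mem_univ, if_true]
  simp only [alpha, Pi.sub_apply, Pi.smul_apply, hu, omega, Pi.single_eq_same, smul_eq_mul]
  ring

theorem sigmaLin_involutive (N : ℕ) (i : Fin (N + 1)) : Function.Involutive (sigmaLin N i) := by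
  intro v
  have h : sigmaLin N i v = v + (form N v (alpha N i) / ((N : ℝ) - 1)) • alpha N i := rfl
  by_cases hN : (N : ℝ) - 1 = 0
  · simp [sigmaLin, hN]
  · have h2 : sigmaLin N i (sigmaLin N i v) = sigmaLin N i v
        + (form N (sigmaLin N i v) (alpha N i) / ((N : ℝ) - 1)) • alpha N i := rfl
    have h3 : form N (sigmaLin N i v) (alpha N i) = - form N v (alpha N i) := by
      rw [h]
      simp only [map_add, map_smul, LinearMap.add_apply, LinearMap.smul_apply, form_alpha_self,
        smul_eq_mul]
      field_simp
      ring
    rw [h2, h3, h, neg_div, neg_smul]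
    abel

/-- The reflection `σ_i`, as a linear automorphism. -/
def sigma (N : ℕ) (i : Fin (N + 1)) : V N ≃ₗ[ℝ] V N :=
  LinearEquiv.ofInvolutive (sigmaLin N i) (sigmaLin_involutive N i)

/-- `W_S`, the group of linear automorphisms generated by the `σ_s` with `s ∈ S`. -/
def WS (N : ℕ) (S : Finset (Fin (N + 1))) : Subgroup (V N ≃ₗ[ℝ] V N) :=
  Subgroup.closure (sigma N '' (S : Set (Fin (N + 1))))

/-- `W`, the group generated by all the reflections `σ_i`. -/
def W (N : ℕ) : Subgroup (V N ≃ₗ[ℝ] V N) := WS N Finset.univ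

/-- `A_S`, the set of all `∑_{s ∈ S} x_s ω_s` with `x_s > 0`; in particular `A_∅ = {0}`. -/
def openFace (N : ℕ) (S : Finset (Fin (N + 1))) : Set (V N) :=
  {v | ∃ x : Fin (N + 1) → ℝ, (∀ s ∈ S, 0 < x s) ∧ v = ∑ s ∈ S, x s • omega N s}

/-- The closure of the open simplicial cone `A` spanned by all the `ω_i`. -/
def closedChamber (N : ℕ) : Set (V N) := closure (openFace N Finset.univ)

/-- The Tits cone: the union of the `W`-translates of the closed chamber. -/
def titsCone (N : ℕ) : Set (V N) := {y | ∃ w ∈ W N, ∃ x ∈ closedChamber N, y = w x}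

/-- The closure of the Tits cone. -/
def closedTitsCone (N : ℕ) : Set (V N) := closure (titsCone N)

/-- The component of `{v | ⟨v, v⟩ > 0}` that meets the open chamber: the form has signature
`(1, N)` for `N ≥ 2`, the vector `u` lies in the open chamber and `⟨u, u⟩ > 0`, so the sign of
`⟨v, u⟩` tells the two components apart. -/
def hypCone (N : ℕ) : Set (V N) := {v | 0 < form N v v ∧ 0 < form N v (uVec N)}

/-- The quotient topology on the real projective space. -/
instance projTopology (N : ℕ) : TopologicalSpace (ℙ ℝ (V N)) :=
  TopologicalSpace.coinduced (fun v : {v : V N // v ≠ 0} => Projectivization.mk ℝ v.1 v.2)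
    inferInstance

/-- The orbit `W_S · [v]` in projective space (for `v ≠ 0`). -/
def projOrbit (N : ℕ) (S : Finset (Fin (N + 1))) (v : V N) : Set (ℙ ℝ (V N)) :=
  {l | ∃ w ∈ WS N S, ∃ h : w v ≠ 0, l = Projectivization.mk ℝ (w v) h}

/-- The limit set `Λ_S` of `W_S`: the accumulation points in projective space of an orbit
`W_S · [v]` of a point `[v]` of hyperbolic space. -/
def limitSet (N : ℕ) (S : Finset (Fin (N + 1))) : Set (ℙ ℝ (V N)) :=
  {l | ∃ v ∈ hypCone N, AccPt l (Filter.principal (projOrbit N S v))}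

/-- The lift of `Λ_S` to the vector space: the nonzero vectors of the closed Tits cone whose
class lies in `Λ_S`. -/
def liftedLimitSet (N : ℕ) (S : Finset (Fin (N + 1))) : Set (V N) :=
  {x | x ∈ closedTitsCone N ∧ ∃ h : x ≠ 0, Projectivization.mk ℝ x h ∈ limitSet N S}

/-- The data `(w, S_d, S_r, q_d, q_r)` present `p` as `w q_d + w q_r`, where `q_d ∈ A_{S_d}`,
`q_r` lies in the lifted limit set of `W_{S_r}` (or `S_r = ∅` and `q_r = 0`, when there is no
recurrent part), and `S_d`, `S_r` are disjoint. -/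
def IsPresentation (N : ℕ) (p : V N) (w : V N ≃ₗ[ℝ] V N) (Sd Sr : Finset (Fin (N + 1)))
    (qd qr : V N) : Prop :=
  w ∈ W N ∧ Disjoint Sd Sr ∧ qd ∈ openFace N Sd ∧
    (qr ∈ liftedLimitSet N Sr ∨ (Sr = ∅ ∧ qr = 0)) ∧ p = w qd + w qr

/-- A presentation of `p` with `|S_d|` as large as possible among all presentations of `p`; in
the parabolic case `|S_d| = N - 1` the recurrent part is moreover required to be absent. -/
def IsMaximalPresentation (N : ℕ) (p : V N) (w : V N ≃ₗ[ℝ] V N) (Sd Sr : Finset (Fin (N + 1)))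
    (qd qr : V N) : Prop :=
  IsPresentation N p w Sd Sr qd qr ∧
    (∀ (w' : V N ≃ₗ[ℝ] V N) (Sd' Sr' : Finset (Fin (N + 1))) (qd' qr' : V N),
      IsPresentation N p w' Sd' Sr' qd' qr' → Sd'.card ≤ Sd.card) ∧
    (Sd.card = N - 1 → Sr = ∅)

end

end Wehler

namespace Wehler

open Filter Topology

variable {N : ℕ}

/-! In coordinates, `σ_i` negates `x i` and adds `2 * x i` to every other coordinate. Reflecting at
a positive coordinate therefore preserves the pair sums that involve it and raises the others, so
all vectors of the closed Tits cone have nonnegative pair sums and at most one negative coordinate.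
Reflecting repeatedly at that coordinate (`descend`) is a deterministic process. It lowers the
coordinate sum, which stays nonnegative, so for a point outside the Tits cone it runs forever and
converges to some `L`. At least three coordinates are reflected infinitely often, and `L` vanishes
there (`descent_limit`). The other ingredient is Cauchy–Schwarz: the form is negative definite on
vectors supported on fewer than `N - 1` coordinates (`eq_zero_of_form_nonneg`).

Let `p` lie outside the Tits cone. Existence: late in the descent only the set `S` of recurring
letters is used. `W_S` fixes `L` and drives the difference to `L` to zero, so this difference is
isotropic and lies over `Λ_S` (`mem_liftedLimitSet_of_tendsto`); `L` is the transient part.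
Uniqueness: in any presentation the `W_{S_r}`-images of `q_r` are nonnegative off `S_r`
(`apply_nonneg_of_mem_liftedLimitSet`), so the descent of `q_d + q_r` uses letters of `S_r` only,
fixes `q_d`, and has limit `q_d` by negative definiteness (`transient_recurrent`). As the descent is
deterministic, its limit carried back to `p` does not depend on the presentation.

If `p` lies in the Tits cone, a presentation with a recurrent part can be moved into the chamber.
Negative definiteness then forces a face of dimension `N - 1` with no recurrent part
(`IsPresentation.exists_of_mem_titsCone`), so maximal presentations have `p_d = p` and `p_r = 0`. -/

/-! ### The form and the reflections in coordinates -/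

theorem form_apply (x y : V N) :
    form N x y = (∑ i, x i) * ∑ i, y i - ((N : ℝ) - 1) * ∑ i, x i * y i := by
  have h : ∀ i j, x i * (if i = j then -((N : ℝ) - 2) else 1) * y j
      = x i * y j - ((N : ℝ) - 1) * (if i = j then x i * y j else 0) := by
    intro i j
    split_ifs <;> ring
  simp only [form, Matrix.toBilin'_apply, Matrix.of_apply, h, Finset.sum_sub_distrib,
    ← Finset.mul_sum, Finset.sum_ite_eq, Finset.mem_univ, if_true, Finset.sum_mul_sum]

theorem form_comm (x y : V N) : form N x y = form N y x := by
  simp only [form_apply, mul_comm]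

@[simp]
theorem uVec_apply (k : Fin (N + 1)) : uVec N k = 1 := by
  simp [uVec, omega, Finset.sum_apply, Pi.single_apply]

theorem alpha_apply (i k : Fin (N + 1)) : alpha N i k = 1 - 2 * (if k = i then 1 else 0) := by
  simp [alpha, omega, Pi.single_apply]

theorem sum_uVec : ∑ k, uVec N k = (N : ℝ) + 1 := by
  simp

theorem form_uVec (x : V N) : form N x (uVec N) = 2 * ∑ k, x k := by
  rw [form_apply, sum_uVec]
  simp only [uVec_apply, mul_one]
  ring

theorem form_alpha (x : V N) (i : Fin (N + 1)) :
    form N x (alpha N i) = 2 * ((N : ℝ) - 1) * x i := by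
  rw [form_apply]
  simp only [alpha_apply, mul_sub, mul_one, mul_ite, mul_zero, Finset.sum_sub_distrib,
    Finset.sum_ite_eq', Finset.mem_univ, if_true, Finset.sum_const, Finset.card_univ,
    Fintype.card_fin, nsmul_eq_mul]
  push_cast
  ring

theorem pos_sub_one (hN : 2 ≤ N) : (0 : ℝ) < N - 1 := by
  have : (2 : ℝ) ≤ N := by exact_mod_cast hN
  linarith

theorem sigma_eq (hN : 2 ≤ N) (i : Fin (N + 1)) (x : V N) :
    sigma N i x = x + (2 * x i) • alpha N i := by
  change x + (form N x (alpha N i) / ((N : ℝ) - 1)) • alpha N i = _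
  rw [form_alpha]
  have := (pos_sub_one hN).ne'
  congr 2
  field_simp

theorem sigma_apply_self (hN : 2 ≤ N) (i : Fin (N + 1)) (x : V N) : sigma N i x i = -x i := by
  simp only [sigma_eq hN, Pi.add_apply, Pi.smul_apply, alpha_apply, smul_eq_mul, if_true]
  ring

theorem sigma_apply_of_ne (hN : 2 ≤ N) {i k : Fin (N + 1)} (h : k ≠ i) (x : V N) :
    sigma N i x k = x k + 2 * x i := by
  simp [sigma_eq hN, alpha_apply, h]

theorem sigma_eq_self (hN : 2 ≤ N) {i : Fin (N + 1)} {x : V N} (h : x i = 0) :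
    sigma N i x = x := by
  simp [sigma_eq hN, h]

@[simp]
theorem sigma_sigma (i : Fin (N + 1)) (x : V N) : sigma N i (sigma N i x) = x :=
  sigmaLin_involutive N i x

theorem sigma_inv (i : Fin (N + 1)) : (sigma N i)⁻¹ = sigma N i :=
  inv_eq_of_mul_eq_one_left (LinearEquiv.ext fun x => sigma_sigma i x)

theorem sum_sigma (hN : 2 ≤ N) (i : Fin (N + 1)) (x : V N) :
    ∑ k, sigma N i x k = ∑ k, x k + 2 * ((N : ℝ) - 1) * x i := by
  have h := form_alpha (uVec N) i
  rw [form_comm, form_uVec, uVec_apply] at h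
  simp only [sigma_eq hN, Pi.add_apply, Pi.smul_apply, smul_eq_mul, Finset.sum_add_distrib,
    ← Finset.mul_sum]
  linear_combination x i * h

theorem form_sigma (hN : 2 ≤ N) (i : Fin (N + 1)) (x y : V N) :
    form N (sigma N i x) (sigma N i y) = form N x y := by
  simp only [sigma_eq hN, map_add, map_smul, LinearMap.add_apply, LinearMap.smul_apply,
    smul_eq_mul, form_alpha, form_comm (alpha N i), alpha_apply i i, if_true]
  ring

theorem sigma_mem_WS {S : Finset (Fin (N + 1))} {i : Fin (N + 1)} (hi : i ∈ S) :
    sigma N i ∈ WS N S :=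
  Subgroup.subset_closure ⟨i, hi, rfl⟩

theorem WS_mono {S T : Finset (Fin (N + 1))} (h : S ⊆ T) : WS N S ≤ WS N T :=
  Subgroup.closure_mono (Set.image_mono (by exact_mod_cast h))

theorem WS_le_W (S : Finset (Fin (N + 1))) : WS N S ≤ W N :=
  WS_mono (Finset.subset_univ S)

@[elab_as_elim]
theorem WS_induction {S : Finset (Fin (N + 1))}
    {P : (w : V N ≃ₗ[ℝ] V N) → w ∈ WS N S → Prop} (one : P 1 (one_mem _))
    (mul : ∀ i (hi : i ∈ S) w (hw : w ∈ WS N S), P w hw →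
      P (sigma N i * w) (mul_mem (sigma_mem_WS hi) hw))
    {w : V N ≃ₗ[ℝ] V N} (hw : w ∈ WS N S) : P w hw := by
  induction hw using Subgroup.closure_induction_left with
  | one => exact one
  | mul_left x hx y hy ih =>
    obtain ⟨i, hi, rfl⟩ := hx
    exact mul i hi y hy ih
  | inv_mul_cancel x hx y hy ih =>
    obtain ⟨i, hi, rfl⟩ := hx
    simp only [sigma_inv]
    exact mul i hi y hy ih

theorem form_WS (hN : 2 ≤ N) {S : Finset (Fin (N + 1))} {w : V N ≃ₗ[ℝ] V N} (hw : w ∈ WS N S)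
    (x y : V N) : form N (w x) (w y) = form N x y := by
  induction hw using WS_induction with
  | one => rfl
  | mul i hi w hw ih => rw [LinearEquiv.mul_apply, LinearEquiv.mul_apply, form_sigma hN, ih]

theorem form_inv_apply (hN : 2 ≤ N) {S : Finset (Fin (N + 1))} {w : V N ≃ₗ[ℝ] V N}
    (hw : w ∈ WS N S) (x y : V N) : form N (w⁻¹ x) y = form N x (w y) := by
  rw [← form_WS hN hw (w⁻¹ x) y, ← LinearEquiv.mul_apply, mul_inv_cancel]
  rfl

theorem WS_apply_eq_self (hN : 2 ≤ N) {S : Finset (Fin (N + 1))} {w : V N ≃ₗ[ℝ] V N}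
    (hw : w ∈ WS N S) {x : V N} (hx : ∀ s ∈ S, x s = 0) : w x = x := by
  induction hw using WS_induction with
  | one => rfl
  | mul i hi w hw ih => rw [LinearEquiv.mul_apply, ih, sigma_eq_self hN (hx i hi)]

theorem WS_empty_apply {w : V N ≃ₗ[ℝ] V N} (hw : w ∈ WS N ∅) (x : V N) : w x = x := by
  induction hw using WS_induction with
  | one => rfl
  | mul i hi => simp at hi

/-! ### The chamber and the Tits cone -/

theorem mem_openFace {S : Finset (Fin (N + 1))} {x : V N} :
    x ∈ openFace N S ↔ (∀ s ∈ S, 0 < x s) ∧ ∀ s ∉ S, x s = 0 := by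
  have key : ∀ y : V N, ∀ k, (∑ s ∈ S, y s • omega N s) k = if k ∈ S then y k else 0 := by
    intro y k
    simp [omega, Finset.sum_apply, Pi.single_apply]
  constructor
  · rintro ⟨y, hy, rfl⟩
    refine ⟨fun s hs => ?_, fun s hs => ?_⟩
    · rw [key, if_pos hs]
      exact hy s hs
    · rw [key, if_neg hs]
  · rintro ⟨h, h'⟩
    refine ⟨x, h, funext fun k => ?_⟩
    rw [key]
    split_ifs with hk
    · rfl
    · exact h' k hk

theorem mem_closedChamber {x : V N} : x ∈ closedChamber N ↔ ∀ i, 0 ≤ x i := by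
  have : openFace N Finset.univ = Set.univ.pi fun _ => Set.Ioi (0 : ℝ) := by
    ext y
    simp [mem_openFace]
  rw [closedChamber, this, closure_pi_set]
  simp [Pi.le_def]

theorem exists_mem_openFace {x : V N} (hx : x ∈ closedChamber N) :
    ∃ S : Finset (Fin (N + 1)), x ∈ openFace N S := by
  classical
  refine ⟨Finset.univ.filter fun i => x i ≠ 0, mem_openFace.2 ⟨fun s hs => ?_, fun s hs => ?_⟩⟩
  · exact lt_of_le_of_ne (mem_closedChamber.1 hx s) (Finset.mem_filter.1 hs).2.symm
  · simpa using hs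

theorem openFace_subset_closedChamber (S : Finset (Fin (N + 1))) :
    openFace N S ⊆ closedChamber N := by
  intro x hx
  rw [mem_openFace] at hx
  refine mem_closedChamber.2 fun i => ?_
  by_cases hi : i ∈ S
  · exact (hx.1 i hi).le
  · exact (hx.2 i hi).ge

/-! ### Ascending reflections and nonnegative pair sums -/

/-- The vectors reached from `B` by the reflections `σ_s`, `s ∈ S`, where `σ_s` is applied only
to vectors on its positive side. -/
inductive Reach (S : Finset (Fin (N + 1))) (B : Set (V N)) : V N → Prop
  | base {x : V N} (hx : x ∈ B) : Reach S B x
  | step {x : V N} {s : Fin (N + 1)} (hs : s ∈ S) (hpos : 0 < x s) (hx : Reach S B x) :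
      Reach S B (sigma N s x)

/-- The vectors all of whose sums of two distinct coordinates are nonnegative. -/
def pairCone (N : ℕ) : Set (V N) := {x | ∀ i j, i ≠ j → 0 ≤ x i + x j}

theorem isClosed_pairCone : IsClosed (pairCone N) := by
  simp only [pairCone, Set.ofPred_forall]
  refine isClosed_iInter fun i => isClosed_iInter fun j => isClosed_iInter fun _ => ?_
  exact isClosed_le continuous_const (by fun_prop)

theorem closedChamber_subset_pairCone : closedChamber N ⊆ pairCone N := fun _ hx i j _ =>
  add_nonneg (mem_closedChamber.1 hx i) (mem_closedChamber.1 hx j)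

theorem pos_of_neg_of_mem_pairCone {x : V N} (hx : x ∈ pairCone N) {i j : Fin (N + 1)}
    (hij : j ≠ i) (hi : x i < 0) : 0 < x j := by
  have := hx j i hij
  linarith

theorem eq_of_neg_of_neg {x : V N} (hx : x ∈ pairCone N) {i j : Fin (N + 1)}
    (hi : x i < 0) (hj : x j < 0) : i = j := by
  by_contra h
  exact absurd (pos_of_neg_of_mem_pairCone hx h hj) (not_lt.2 hi.le)

/-- A step at `x s > 0` keeps the pair sums containing `s` and adds `4 * x s` to all others. -/
theorem Reach.mem_pairCone (hN : 2 ≤ N) {S : Finset (Fin (N + 1))} {B : Set (V N)}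
    (hB : B ⊆ pairCone N) {x : V N} (h : Reach S B x) : x ∈ pairCone N := by
  induction h with
  | base hx => exact hB hx
  | @step x s hs hpos hx ih =>
    intro i j hij
    by_cases hi : i = s
    · subst hi
      rw [sigma_apply_self hN, sigma_apply_of_ne hN hij.symm]
      linarith [ih i j hij]
    · by_cases hj : j = s
      · subst hj
        rw [sigma_apply_self hN, sigma_apply_of_ne hN hij]
        linarith [ih i j hij]
      · rw [sigma_apply_of_ne hN hi, sigma_apply_of_ne hN hj]
        linarith [ih i j hij]

theorem Reach.mem_or_neg (hN : 2 ≤ N) {S : Finset (Fin (N + 1))} {B : Set (V N)} {x : V N}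
    (h : Reach S B x) : x ∈ B ∨ ∃ s ∈ S, x s < 0 := by
  cases h with
  | base hx => exact Or.inl hx
  | @step x s hs hpos hx =>
    refine Or.inr ⟨s, hs, ?_⟩
    rw [sigma_apply_self hN]
    linarith

theorem Reach.sigma (hN : 2 ≤ N) {S : Finset (Fin (N + 1))} {B : Set (V N)}
    (hB : B ⊆ pairCone N) (hBS : ∀ x ∈ B, ∀ s ∈ S, 0 ≤ x s) {x : V N} (h : Reach S B x)
    {i : Fin (N + 1)} (hi : i ∈ S) : Reach S B (sigma N i x) := by
  rcases lt_trichotomy (x i) 0 with hneg | h0 | hpos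
  · cases h with
    | base hx => exact absurd (hBS _ hx i hi) (not_le.2 hneg)
    | @step y s hs hpos hy =>
      have hs' : Wehler.sigma N s y s < 0 := by
        rw [sigma_apply_self hN]
        linarith
      -- The only negative coordinate is the one reflected last, so `σ_i` undoes the last step.
      have := eq_of_neg_of_neg ((Reach.step hs hpos hy).mem_pairCone hN hB) hneg hs'
      subst this
      rwa [sigma_sigma]
  · rwa [sigma_eq_self hN h0]
  · exact Reach.step hi hpos h

theorem Reach.WS (hN : 2 ≤ N) {S : Finset (Fin (N + 1))} {B : Set (V N)}
    (hB : B ⊆ pairCone N) (hBS : ∀ x ∈ B, ∀ s ∈ S, 0 ≤ x s) {x : V N} (h : Reach S B x)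
    {w : V N ≃ₗ[ℝ] V N} (hw : w ∈ WS N S) : Reach S B (w x) := by
  induction hw using WS_induction with
  | one => exact h
  | mul i hi w hw ih => exact ih.sigma hN hB hBS hi

theorem apply_mem_titsCone {w : V N ≃ₗ[ℝ] V N} (hw : w ∈ W N) {x : V N} (hx : x ∈ titsCone N) :
    w x ∈ titsCone N := by
  obtain ⟨w', hw', y, hy, rfl⟩ := hx
  exact ⟨w * w', mul_mem hw hw', y, hy, rfl⟩

theorem inv_apply_apply (w : V N ≃ₗ[ℝ] V N) (x : V N) : w⁻¹ (w x) = x := by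
  rw [← LinearEquiv.mul_apply, inv_mul_cancel]
  rfl

theorem apply_inv_apply (w : V N ≃ₗ[ℝ] V N) (x : V N) : w (w⁻¹ x) = x := by
  rw [← LinearEquiv.mul_apply, mul_inv_cancel]
  rfl

theorem apply_mem_titsCone_iff {w : V N ≃ₗ[ℝ] V N} (hw : w ∈ W N) {x : V N} :
    w x ∈ titsCone N ↔ x ∈ titsCone N := by
  refine ⟨fun h => ?_, apply_mem_titsCone hw⟩
  simpa only [inv_apply_apply] using apply_mem_titsCone (inv_mem hw) h

theorem closedChamber_subset_titsCone : closedChamber N ⊆ titsCone N :=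
  fun x hx => ⟨1, one_mem _, x, hx, rfl⟩

theorem sigma_mem_W (i : Fin (N + 1)) : sigma N i ∈ W N := sigma_mem_WS (Finset.mem_univ i)

theorem mem_titsCone_iff_reach (hN : 2 ≤ N) {x : V N} :
    x ∈ titsCone N ↔ Reach Finset.univ (closedChamber N) x := by
  constructor
  · rintro ⟨w, hw, y, hy, rfl⟩
    exact (Reach.base hy).WS hN closedChamber_subset_pairCone
      (fun x hx s _ => mem_closedChamber.1 hx s) hw
  · intro h
    induction h with
    | base hx => exact closedChamber_subset_titsCone hx
    | step hs hpos hx ih => exact apply_mem_titsCone (sigma_mem_W _) ih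

theorem closedTitsCone_subset_pairCone (hN : 2 ≤ N) : closedTitsCone N ⊆ pairCone N :=
  closure_minimal (fun _ hx => ((mem_titsCone_iff_reach hN).1 hx).mem_pairCone hN
    closedChamber_subset_pairCone) isClosed_pairCone

theorem continuous_equiv (w : V N ≃ₗ[ℝ] V N) : Continuous w :=
  LinearMap.continuous_of_finiteDimensional (w : V N →ₗ[ℝ] V N)

theorem apply_mem_closedTitsCone {w : V N ≃ₗ[ℝ] V N} (hw : w ∈ W N) {x : V N}
    (hx : x ∈ closedTitsCone N) : w x ∈ closedTitsCone N :=
  map_mem_closure (continuous_equiv w) hx fun _ hy => apply_mem_titsCone hw hy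

theorem image_closedTitsCone {w : V N ≃ₗ[ℝ] V N} (hw : w ∈ W N) :
    w '' closedTitsCone N = closedTitsCone N := by
  refine Set.Subset.antisymm ?_ fun x hx => ?_
  · rintro _ ⟨x, hx, rfl⟩
    exact apply_mem_closedTitsCone hw hx
  · exact ⟨w⁻¹ x, apply_mem_closedTitsCone (inv_mem hw) hx, apply_inv_apply w x⟩

theorem apply_mem_frontier {w : V N ≃ₗ[ℝ] V N} (hw : w ∈ W N) {x : V N}
    (hx : x ∈ frontier (closedTitsCone N)) : w x ∈ frontier (closedTitsCone N) := by
  have h := w.toContinuousLinearEquiv.toHomeomorph.image_frontier (closedTitsCone N)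
  have h' : w.toContinuousLinearEquiv.toHomeomorph '' closedTitsCone N = closedTitsCone N :=
    image_closedTitsCone hw
  rw [h'] at h
  rw [← h]
  exact ⟨x, hx, rfl⟩

theorem apply_mem_frontier_iff {w : V N ≃ₗ[ℝ] V N} (hw : w ∈ W N) {x : V N} :
    w x ∈ frontier (closedTitsCone N) ↔ x ∈ frontier (closedTitsCone N) := by
  refine ⟨fun h => ?_, apply_mem_frontier hw⟩
  simpa only [inv_apply_apply] using apply_mem_frontier (inv_mem hw) h

theorem frontier_subset_closedTitsCone : frontier (closedTitsCone N) ⊆ closedTitsCone N :=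
  isClosed_closure.frontier_subset

theorem exists_two_ne (hN : 2 ≤ N) (i : Fin (N + 1)) :
    ∃ j k : Fin (N + 1), j ≠ i ∧ k ≠ i ∧ j ≠ k := by
  have h : 2 ≤ (Finset.univ.erase i).card := by
    rw [Finset.card_erase_of_mem (Finset.mem_univ i), Finset.card_univ, Fintype.card_fin]
    exact hN
  obtain ⟨j, hj, k, hk, hjk⟩ := Finset.one_lt_card.1 h
  exact ⟨j, k, Finset.ne_of_mem_erase hj, Finset.ne_of_mem_erase hk, hjk⟩

/-- A negative coordinate is compensated by any one other coordinate, and since `N ≥ 2` a further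
positive one is left over. -/
theorem sum_pos_of_mem_pairCone (hN : 2 ≤ N) {x : V N} (hx : x ∈ pairCone N) (h0 : x ≠ 0) :
    0 < ∑ k, x k := by
  by_cases h : ∃ i, x i < 0
  · obtain ⟨i, hi⟩ := h
    obtain ⟨j, k, hj, hk, hjk⟩ := exists_two_ne hN i
    have hrest : x j ≤ ∑ l ∈ (Finset.univ.erase i).erase k, x l :=
      Finset.single_le_sum (f := x)
        (fun l hl => (pos_of_neg_of_mem_pairCone hx
          (Finset.ne_of_mem_erase (Finset.mem_of_mem_erase hl)) hi).le)
        (by simp [hj, hjk])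
    have h1 := Finset.add_sum_erase Finset.univ x (Finset.mem_univ i)
    have h2 := Finset.add_sum_erase (Finset.univ.erase i) x (a := k) (by simp [hk])
    have := hx i k hk.symm
    have := pos_of_neg_of_mem_pairCone hx hj hi
    linarith
  · push Not at h
    obtain ⟨i, hi⟩ : ∃ i, x i ≠ 0 := by
      by_contra hc
      push Not at hc
      exact h0 (funext hc)
    exact Finset.sum_pos' (fun k _ => h k) ⟨i, Finset.mem_univ i, lt_of_le_of_ne (h i) hi.symm⟩

theorem sum_nonneg_of_mem_pairCone (hN : 2 ≤ N) {x : V N} (hx : x ∈ pairCone N) :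
    0 ≤ ∑ k, x k := by
  by_cases h0 : x = 0
  · simp [h0]
  · exact (sum_pos_of_mem_pairCone hN hx h0).le

theorem exists_neg_of_notMem_titsCone {x : V N} (hx : x ∉ titsCone N) : ∃ i, x i < 0 := by
  by_contra h
  push Not at h
  exact hx (closedChamber_subset_titsCone (mem_closedChamber.2 h))

theorem openFace_subset_interior (hN : 2 ≤ N) {S : Finset (Fin (N + 1))} (hS : N ≤ S.card) :
    openFace N S ⊆ interior (closedTitsCone N) := by
  intro x hx
  rw [mem_openFace] at hx
  have hc : Sᶜ.card ≤ 1 := by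
    rw [Finset.card_compl, Fintype.card_fin]
    omega
  obtain ⟨i, hi⟩ := Finset.card_le_one_iff_subset_singleton.1 hc
  have hmem : ∀ k, k ≠ i → k ∈ S := by
    intro k hk
    by_contra hkS
    exact hk (Finset.mem_singleton.1 (hi (Finset.mem_compl.2 hkS)))
  have hxi : 0 ≤ x i := mem_closedChamber.1
    (openFace_subset_closedChamber S (mem_openFace.2 hx)) i
  -- This open set lies in the union of the chamber and its neighbour across the wall `x i = 0`.
  refine mem_interior.2 ⟨{y | ∀ k, k ≠ i → 0 < y k ∧ 0 < y k + 2 * y i}, ?_, ?_, ?_⟩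
  · intro y hy
    refine subset_closure ?_
    rcases le_or_gt 0 (y i) with h | h
    · refine closedChamber_subset_titsCone (mem_closedChamber.2 fun k => ?_)
      by_cases hk : k = i
      · rwa [hk]
      · exact (hy k hk).1.le
    · rw [← apply_mem_titsCone_iff (sigma_mem_W i)]
      refine closedChamber_subset_titsCone (mem_closedChamber.2 fun k => ?_)
      by_cases hk : k = i
      · rw [hk, sigma_apply_self hN]
        linarith
      · rw [sigma_apply_of_ne hN hk]
        exact (hy k hk).2.le
  · simp only [Set.ofPred_forall]
    refine isOpen_iInter_of_finite fun k => isOpen_iInter_of_finite fun _ => ?_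
    exact (isOpen_lt continuous_const (continuous_apply k)).inter
      (isOpen_lt continuous_const
        ((continuous_apply k).add (continuous_const.mul (continuous_apply i))))
  · intro k hk
    have := hx.1 k (hmem k hk)
    exact ⟨this, by linarith⟩

theorem exists_sub_smul_mem_of_mem_interior {A : Set (V N)} {x : V N} (hx : x ∈ interior A) :
    ∃ t : ℝ, 0 < t ∧ x - t • uVec N ∈ A := by
  have htend : Tendsto (fun t : ℝ => x - t • uVec N) (𝓝[>] 0) (𝓝 x) := by
    have : Continuous fun t : ℝ => x - t • uVec N := by fun_prop
    simpa using (this.tendsto 0).mono_left nhdsWithin_le_nhds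
  obtain ⟨t, ht, ht0⟩ := ((htend.eventually (isOpen_interior.mem_nhds hx)).and
    self_mem_nhdsWithin).exists
  exact ⟨t, ht0, interior_subset ht⟩

/-- Two coordinates vanish, so subtracting any positive multiple of `u` makes their pair sum
negative. -/
theorem openFace_subset_frontier (hN : 2 ≤ N) {S : Finset (Fin (N + 1))}
    (hS : S.card ≤ N - 1) : openFace N S ⊆ frontier (closedTitsCone N) := by
  intro x hx
  have hxT : x ∈ closedTitsCone N :=
    subset_closure (closedChamber_subset_titsCone (openFace_subset_closedChamber S hx))
  rw [mem_openFace] at hx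
  have hc : 1 < Sᶜ.card := by
    rw [Finset.card_compl, Fintype.card_fin]
    omega
  obtain ⟨i, hi, j, hj, hij⟩ := Finset.one_lt_card.1 hc
  refine ⟨subset_closure hxT, fun hint => ?_⟩
  obtain ⟨t, ht0, ht⟩ := exists_sub_smul_mem_of_mem_interior hint
  have := closedTitsCone_subset_pairCone hN ht i j hij
  simp only [Pi.sub_apply, Pi.smul_apply, uVec_apply, smul_eq_mul,
    hx.2 i (Finset.mem_compl.1 hi), hx.2 j (Finset.mem_compl.1 hj)] at this
  linarith

/-! ### The form and the hyperbolic cone -/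

theorem continuous_form_self : Continuous fun x : V N => form N x x := by
  simp only [form_apply]
  fun_prop

theorem continuous_sum : Continuous fun x : V N => ∑ k, x k := by
  fun_prop

/-- Cauchy–Schwarz bounds the squared coordinate sum by `S.card` times the sum of squares, while the
form subtracts `N - 1` times that sum. -/
theorem eq_zero_of_form_nonneg {S : Finset (Fin (N + 1))} (hS : S.card < N - 1)
    {x : V N} (hx : ∀ k ∉ S, x k = 0) (hf : 0 ≤ form N x x) : x = 0 := by
  have hN : 2 ≤ N := by omega
  have hS' : (S.card : ℝ) < N - 1 := by
    have h : ((S.card + 1 : ℕ) : ℝ) < (N : ℕ) := by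
      exact_mod_cast (by omega : S.card + 1 < N)
    push_cast at h
    linarith
  have h1 : ∑ k, x k = ∑ k ∈ S, x k :=
    (Finset.sum_subset (Finset.subset_univ S) fun k _ hk => hx k hk).symm
  have h2 : ∑ k, x k * x k = ∑ k ∈ S, x k ^ 2 := by
    simp only [← pow_two]
    exact (Finset.sum_subset (Finset.subset_univ S) fun k _ hk => by simp [hx k hk]).symm
  have h3 := sq_sum_le_card_mul_sum_sq (s := S) (f := x)
  rw [form_apply, h1, h2] at hf
  have h4 : 0 ≤ ∑ k ∈ S, x k ^ 2 := Finset.sum_nonneg fun k _ => sq_nonneg _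
  have h5 : ∑ k ∈ S, x k ^ 2 = 0 := by nlinarith
  have h6 := (Finset.sum_eq_zero_iff_of_nonneg fun k _ => sq_nonneg (x k)).1 h5
  funext k
  by_cases hk : k ∈ S
  · exact pow_eq_zero_iff two_ne_zero |>.1 (h6 k hk)
  · exact hx k hk

theorem mem_hypCone {x : V N} : x ∈ hypCone N ↔ 0 < form N x x ∧ 0 < ∑ k, x k := by
  change 0 < form N x x ∧ 0 < form N x (uVec N) ↔ _
  rw [form_uVec]
  constructor <;> rintro ⟨h, h'⟩ <;> exact ⟨h, by linarith⟩

/-- The form is a product of coordinate sums minus a multiple of the Euclidean product;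
Cauchy–Schwarz for the latter makes the former dominate. -/
theorem form_pos_of_mem_hypCone (hN : 2 ≤ N) {x y : V N} (hx : x ∈ hypCone N)
    (hy : y ∈ hypCone N) : 0 < form N x y := by
  rw [mem_hypCone, form_apply] at hx hy
  rw [form_apply]
  have hc := pos_sub_one hN
  have hcs := Finset.sum_mul_sq_le_sq_mul_sq Finset.univ x y
  simp only [pow_two (x _), pow_two (y _)] at hcs
  have hx2 : 0 ≤ ∑ k, x k * x k := Finset.sum_nonneg fun k _ => mul_self_nonneg _
  have hy2 : 0 ≤ ∑ k, y k * y k := Finset.sum_nonneg fun k _ => mul_self_nonneg _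
  obtain ⟨hxf, hxs⟩ := hx
  obtain ⟨hyf, hys⟩ := hy
  have h1 : (((N : ℝ) - 1) * ∑ k, x k * x k) * (((N : ℝ) - 1) * ∑ k, y k * y k)
      < ((∑ k, x k) * ∑ k, x k) * ((∑ k, y k) * ∑ k, y k) := by
    refine mul_lt_mul'' (by linarith) (by linarith) ?_ ?_ <;> positivity
  have h2 : (((N : ℝ) - 1) * ∑ k, x k * y k) ^ 2 < ((∑ k, x k) * ∑ k, y k) ^ 2 := by
    calc (((N : ℝ) - 1) * ∑ k, x k * y k) ^ 2
        = ((N : ℝ) - 1) ^ 2 * (∑ k, x k * y k) ^ 2 := by ring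
      _ ≤ ((N : ℝ) - 1) ^ 2 * ((∑ k, x k * x k) * ∑ k, y k * y k) := by gcongr
      _ = (((N : ℝ) - 1) * ∑ k, x k * x k) * (((N : ℝ) - 1) * ∑ k, y k * y k) := by ring
      _ < ((∑ k, x k) * ∑ k, x k) * ((∑ k, y k) * ∑ k, y k) := h1
      _ = ((∑ k, x k) * ∑ k, y k) ^ 2 := by ring
  have := lt_of_pow_lt_pow_left₀ 2 (by positivity) h2
  linarith

theorem form_uVec_uVec : form N (uVec N) (uVec N) = 2 * ((N : ℝ) + 1) := by
  rw [form_uVec, sum_uVec]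

theorem uVec_mem_hypCone : uVec N ∈ hypCone N := by
  rw [mem_hypCone, form_uVec_uVec, sum_uVec]
  constructor <;> positivity

theorem sigma_mem_hypCone (hN : 2 ≤ N) {x : V N} (hx : x ∈ hypCone N) (i : Fin (N + 1)) :
    sigma N i x ∈ hypCone N := by
  have hu : sigma N i (uVec N) ∈ hypCone N := by
    rw [mem_hypCone, form_sigma hN, sum_sigma hN, uVec_apply, sum_uVec, form_uVec_uVec]
    have := pos_sub_one hN
    constructor <;> linarith
  have h := form_pos_of_mem_hypCone hN hx hu
  rw [← form_sigma hN i, sigma_sigma, form_uVec] at h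
  rw [mem_hypCone, form_sigma hN]
  exact ⟨(mem_hypCone.1 hx).1, by linarith⟩

theorem WS_mem_hypCone (hN : 2 ≤ N) {S : Finset (Fin (N + 1))} {w : V N ≃ₗ[ℝ] V N}
    (hw : w ∈ WS N S) {x : V N} (hx : x ∈ hypCone N) : w x ∈ hypCone N := by
  induction hw using WS_induction with
  | one => exact hx
  | mul i hi w hw ih => exact sigma_mem_hypCone hN ih i

theorem ne_zero_of_mem_hypCone {x : V N} (hx : x ∈ hypCone N) : x ≠ 0 := by
  rintro rfl
  simpa using (mem_hypCone.1 hx).2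

theorem mem_closure_hypCone {x : V N} (h : 0 ≤ form N x x) (hs : 0 < ∑ k, x k) :
    x ∈ closure (hypCone N) := by
  have htend : Tendsto (fun t : ℝ => x + t • uVec N) (𝓝[>] 0) (𝓝 x) := by
    have : Continuous fun t : ℝ => x + t • uVec N := by fun_prop
    simpa using (this.tendsto 0).mono_left nhdsWithin_le_nhds
  refine mem_closure_of_tendsto htend ?_
  filter_upwards [self_mem_nhdsWithin] with t ht
  have ht : 0 < t := ht
  rw [mem_hypCone]
  simp only [map_add, map_smul, LinearMap.add_apply, LinearMap.smul_apply, smul_eq_mul,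
    form_comm (uVec N) x, form_uVec x, form_uVec_uVec, Pi.add_apply, Pi.smul_apply, uVec_apply,
    Finset.sum_add_distrib, mul_one, Finset.sum_const, Finset.card_univ, Fintype.card_fin,
    nsmul_eq_mul]
  constructor <;> positivity

/-! ### Descent by reflections at negative coordinates -/

/-- The coordinate sum drops by `2(N-1)|x n (i n)|` at each step and is bounded below, so the step
sizes are summable and the sequence is Cauchy. -/
theorem descent_limit (hN : 2 ≤ N) {x : ℕ → V N} {i : ℕ → Fin (N + 1)}
    (hx : ∀ n, x (n + 1) = sigma N (i n) (x n)) (hneg : ∀ n, x n (i n) < 0)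
    (hsum : ∀ n, 0 ≤ ∑ k, x n k) :
    ∃ (L : V N) (S : Finset (Fin (N + 1))), 3 ≤ S.card ∧ Tendsto x atTop (𝓝 L) ∧
      (∀ s ∈ S, L s = 0) ∧ (∀ s ∈ S, ∃ n, i n = s) ∧ ∀ᶠ n in atTop, i n ∈ S := by
  classical
  have hc := pos_sub_one hN
  have hpartial : ∀ n, ∑ m ∈ Finset.range n, -x m (i m)
      = (∑ k, x 0 k - ∑ k, x n k) / (2 * ((N : ℝ) - 1)) := by
    intro n
    induction n with
    | zero => simp
    | succ n ih =>
      rw [Finset.sum_range_succ, ih, hx, sum_sigma hN]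
      field_simp
      ring
  have hsummable : Summable fun n => -x n (i n) := by
    refine summable_of_sum_range_le (c := (∑ k, x 0 k) / (2 * ((N : ℝ) - 1)))
      (fun n => neg_nonneg.2 (hneg n).le) fun n => ?_
    rw [hpartial]
    gcongr
    linarith [hsum n]
  have hzero : Tendsto (fun n => x n (i n)) atTop (𝓝 0) := by
    simpa using hsummable.tendsto_atTop_zero.neg
  have hdist : ∀ n, dist (x n) (x n.succ) ≤ 2 * -x n (i n) := by
    intro n
    refine (dist_pi_le_iff (by linarith [hneg n])).2 fun k => ?_
    rw [Nat.succ_eq_add_one, hx, Real.dist_eq]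
    by_cases hk : k = i n
    · rw [hk, sigma_apply_self hN, abs_of_neg (by linarith [hneg n])]
      linarith
    · rw [sigma_apply_of_ne hN hk, abs_of_pos (by linarith [hneg n])]
      linarith
  obtain ⟨L, hL⟩ := cauchySeq_tendsto_of_complete
    (cauchySeq_of_dist_le_of_summable _ hdist (hsummable.mul_left 2))
  have hLk : ∀ k, Tendsto (fun n => x n k) atTop (𝓝 (L k)) := fun k =>
    (continuous_apply k).continuousAt.tendsto.comp hL
  -- `S` consists of the letters that recur infinitely often; the reflected coordinates tend to zero
  -- along them.
  set S : Finset (Fin (N + 1)) := Finset.univ.filter fun j => ∃ᶠ n in atTop, i n = j with hS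
  have hLS : ∀ s ∈ S, L s = 0 := by
    intro s hs
    obtain ⟨φ, hφ, hφs⟩ := extraction_of_frequently_atTop (Finset.mem_filter.1 hs).2
    have h1 := (hLk s).comp hφ.tendsto_atTop
    have h2 := hzero.comp hφ.tendsto_atTop
    refine tendsto_nhds_unique h1 (h2.congr fun n => ?_)
    simp [hφs]
  have hev : ∀ᶠ n in atTop, i n ∈ S := by
    have : ∀ j, ∀ᶠ n in atTop, i n = j → j ∈ S := by
      intro j
      by_cases hj : j ∈ S
      · exact Eventually.of_forall fun _ _ => hj
      · have : ¬∃ᶠ n in atTop, i n = j := by simpa [hS] using hj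
        exact (not_frequently.1 this).mono fun n hn h => absurd h hn
    exact (eventually_all.2 this).mono fun n hn => hn _ rfl
  refine ⟨L, S, ?_, hL, hLS, fun s hs => (Finset.mem_filter.1 hs).2.exists, hev⟩
  -- Consecutive letters differ, so fewer than three recurring letters means exactly two, `a` and
  -- `b`. Then the sum of these two coordinates is constant with limit zero, hence zero, and the
  -- square of the first is constant as well, which contradicts convergence to zero.
  by_contra hcard
  obtain ⟨n₀, hn₀⟩ := eventually_atTop.1 hev
  have hne : i n₀ ≠ i (n₀ + 1) := by
    intro h
    have := hneg (n₀ + 1)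
    rw [← h, hx, sigma_apply_self hN] at this
    linarith [hneg n₀]
  have hSeq : {i n₀, i (n₀ + 1)} = S := by
    refine Finset.eq_of_subset_of_card_le ?_ ?_
    · simp [Finset.insert_subset_iff, hn₀ n₀ le_rfl, hn₀ (n₀ + 1) (Nat.le_succ _)]
    · rw [Finset.card_pair hne]
      omega
  obtain ⟨a, ha⟩ : ∃ a, a = i n₀ := ⟨_, rfl⟩
  obtain ⟨b, hb⟩ : ∃ b, b = i (n₀ + 1) := ⟨_, rfl⟩
  rw [← ha, ← hb] at hne hSeq
  have hLa : L a = 0 := hLS a (by simp [← hSeq])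
  have hLb : L b = 0 := hLS b (by simp [← hSeq])
  have hletter : ∀ m, i (m + n₀) = a ∨ i (m + n₀) = b := by
    intro m
    have := hn₀ (m + n₀) (Nat.le_add_left _ _)
    simpa [← hSeq] using this
  have hstep : ∀ m, x (m + 1 + n₀) = sigma N (i (m + n₀)) (x (m + n₀)) := by
    intro m
    rw [← hx]
    congr 1
    omega
  have hconst : ∀ m, x (m + n₀) a + x (m + n₀) b = x n₀ a + x n₀ b := by
    intro m
    induction m with
    | zero => simp
    | succ m ih =>
      rw [← ih, hstep]
      rcases hletter m with h | h <;> rw [h]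
      · rw [sigma_apply_self hN, sigma_apply_of_ne hN hne.symm]
        ring
      · rw [sigma_apply_self hN, sigma_apply_of_ne hN hne]
        ring
  have hshift : ∀ k, Tendsto (fun m => x (m + n₀) k) atTop (𝓝 (L k)) := fun k =>
    (tendsto_add_atTop_iff_nat (f := fun n => x n k) n₀).2 (hLk k)
  have h0 : x n₀ a + x n₀ b = 0 := by
    have h := (hshift a).add (hshift b)
    rw [hLa, hLb, add_zero] at h
    exact tendsto_nhds_unique (tendsto_const_nhds.congr fun m => (hconst m).symm) h
  have hsq : ∀ m, x (m + n₀) a ^ 2 = x n₀ a ^ 2 := by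
    intro m
    induction m with
    | zero => simp
    | succ m ih =>
      rw [← ih, hstep]
      have hab := (hconst m).trans h0
      rcases hletter m with h | h <;> rw [h]
      · rw [sigma_apply_self hN]
        ring
      · rw [sigma_apply_of_ne hN hne, eq_neg_of_add_eq_zero_right hab]
        ring
  have h1 : x n₀ a ^ 2 = 0 := by
    have h := (hshift a).pow 2
    rw [hLa, zero_pow two_ne_zero] at h
    exact tendsto_nhds_unique (tendsto_const_nhds.congr fun m => (hsq m).symm) h
  have := hneg n₀
  rw [← ha, pow_eq_zero_iff two_ne_zero |>.1 h1] at this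
  exact lt_irrefl _ this

/-- An index of a negative coordinate of `x`, if there is one. -/
noncomputable def negIndex (x : V N) : Fin (N + 1) :=
  Classical.epsilon fun i => x i < 0

theorem negIndex_spec {x : V N} (h : ∃ i, x i < 0) : x (negIndex x) < 0 :=
  Classical.epsilon_spec h

/-- Reflect `x` at a negative coordinate. -/
noncomputable def descend (x : V N) : V N := sigma N (negIndex x) x

theorem iterate_descend_notMem {x : V N} (hx : x ∉ titsCone N) (n : ℕ) :
    descend^[n] x ∉ titsCone N := by
  induction n with
  | zero => exact hx
  | succ n ih =>
    rw [Function.iterate_succ_apply']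
    exact fun h => ih ((apply_mem_titsCone_iff (sigma_mem_W _)).1 h)

theorem iterate_descend_limit (hN : 2 ≤ N) {x : V N} (hx : x ∉ titsCone N)
    (hsum : ∀ n, 0 ≤ ∑ k, (descend^[n] x) k) :
    ∃ (L : V N) (S : Finset (Fin (N + 1))), 3 ≤ S.card ∧
      Tendsto (fun n => descend^[n] x) atTop (𝓝 L) ∧ (∀ s ∈ S, L s = 0) ∧
      (∀ s ∈ S, ∃ n, negIndex (descend^[n] x) = s) ∧ ∀ᶠ n in atTop, negIndex (descend^[n] x) ∈ S :=
  descent_limit hN (fun _ => Function.iterate_succ_apply' _ _ _)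
    (fun n => negIndex_spec (exists_neg_of_notMem_titsCone (iterate_descend_notMem hx n))) hsum

theorem iterate_descend_eq (x : V N) (n : ℕ) : ∃ w ∈ W N, descend^[n] x = w x := by
  induction n with
  | zero => exact ⟨1, one_mem _, rfl⟩
  | succ n ih =>
    obtain ⟨w, hw, h⟩ := ih
    refine ⟨sigma N (negIndex (descend^[n] x)) * w, mul_mem (sigma_mem_W _) hw, ?_⟩
    rw [Function.iterate_succ_apply', LinearEquiv.mul_apply, ← h]
    rfl

/-- Otherwise the descent would converge to a vector of the same positive norm supported on at most
`N - 2` coordinates, where the form is negative definite. -/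
theorem hypCone_subset_titsCone (hN : 2 ≤ N) : hypCone N ⊆ titsCone N := by
  intro x hx
  by_contra hxT
  have hmem : ∀ n, descend^[n] x ∈ hypCone N := by
    intro n
    obtain ⟨w, hw, h⟩ := iterate_descend_eq x n
    rw [h]
    exact WS_mem_hypCone hN hw hx
  obtain ⟨L, S, hS, hL, hLS, -⟩ := iterate_descend_limit hN hxT
    fun n => (mem_hypCone.1 (hmem n)).2.le
  have hform : form N L L = form N x x := by
    refine tendsto_nhds_unique ((continuous_form_self.tendsto L).comp hL)
      (tendsto_const_nhds.congr fun n => ?_)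
    obtain ⟨w, hw, h⟩ := iterate_descend_eq x n
    rw [Function.comp_apply, h, form_WS hN hw]
  have hpos := (mem_hypCone.1 hx).1
  have hL0 : L = 0 := by
    refine eq_zero_of_form_nonneg (S := Sᶜ) ?_ (fun k hk => hLS k (by simpa using hk))
      (hform ▸ hpos.le)
    rw [Finset.card_compl, Fintype.card_fin]
    omega
  rw [hL0] at hform
  simp only [map_zero] at hform
  linarith

theorem sum_ge_one_of_WS (hN : 2 ≤ N) {S : Finset (Fin (N + 1))} {w : V N ≃ₗ[ℝ] V N}
    (hw : w ∈ WS N S) : 1 ≤ ∑ k, w (uVec N) k := by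
  have h := mem_hypCone.1 (WS_mem_hypCone hN hw uVec_mem_hypCone)
  have h1 : form N (w (uVec N)) (w (uVec N)) ≤ (∑ k, w (uVec N) k) * ∑ k, w (uVec N) k := by
    rw [form_apply]
    have := mul_nonneg (pos_sub_one hN).le
      (Finset.sum_nonneg fun k (_ : k ∈ Finset.univ) => mul_self_nonneg (w (uVec N) k))
    linarith
  rw [form_WS hN hw, form_uVec_uVec] at h1
  have : (0 : ℝ) ≤ N := N.cast_nonneg
  nlinarith [h.2]

/-! ### Limit sets -/

theorem mk_eq_mk_iff_mem_span {x y : V N} (hx : x ≠ 0) (hy : y ≠ 0) :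
    Projectivization.mk ℝ x hx = Projectivization.mk ℝ y hy ↔ x ∈ Submodule.span ℝ {y} := by
  rw [Projectivization.mk_eq_mk_iff', Submodule.mem_span_singleton]

theorem isOpen_proj_iff {U : Set (ℙ ℝ (V N))} :
    IsOpen U ↔ IsOpen {x : {v : V N // v ≠ 0} | Projectivization.mk ℝ x.1 x.2 ∈ U} :=
  isOpen_coinduced

theorem continuous_mk :
    Continuous fun v : {v : V N // v ≠ 0} => Projectivization.mk ℝ v.1 v.2 :=
  continuous_coinduced_rng

theorem isOpen_ne_proj (l : ℙ ℝ (V N)) : IsOpen {m : ℙ ℝ (V N) | m ≠ l} := by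
  induction l using Projectivization.ind with
  | h y hy =>
    rw [isOpen_proj_iff]
    have : IsClosed (Submodule.span ℝ {y} : Set (V N)) := Submodule.closed_of_finiteDimensional _
    convert this.isOpen_compl.preimage (continuous_subtype_val (p := fun v : V N => v ≠ 0)) using 1
    ext x
    exact (mk_eq_mk_iff_mem_span x.2 hy).not

/-- A closed cone that contains all but one point of the orbit `W_S v` contains the
accumulation points of the orbit `W_S [v]`. -/
theorem mem_of_accPt {S : Finset (Fin (N + 1))} {q v : V N} {hq : q ≠ 0}
    (hacc : AccPt (Projectivization.mk ℝ q hq) (𝓟 (projOrbit N S v))) {F : Set (V N)}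
    (hF : IsClosed F) (hsmul : ∀ (c : ℝ) (x : V N), c ≠ 0 → x ∈ F → c • x ∈ F) {y : V N}
    (hy : y ≠ 0) (horb : ∀ w ∈ WS N S, w v ∈ F ∨ w v = y) : q ∈ F := by
  by_contra hqF
  -- `U` is an open neighbourhood of `[q]` that meets the orbit at most in `[y]`. If `[q] = [y]`
  -- this already contradicts accumulation; otherwise `[y]` is removed from `U`.
  set U : Set (ℙ ℝ (V N)) := {m | ∃ (x : V N) (hx : x ≠ 0), x ∉ F ∧ Projectivization.mk ℝ x hx = m}
  have hU : ∀ (x : V N) (hx : x ≠ 0), Projectivization.mk ℝ x hx ∈ U ↔ x ∉ F := by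
    intro x hx
    refine ⟨?_, fun h => ⟨x, hx, h, rfl⟩⟩
    rintro ⟨x', hx', h', heq⟩ hxF
    obtain ⟨c, hc⟩ := (Projectivization.mk_eq_mk_iff' _ _ _ _ _).1 heq
    refine h' (hc ▸ hsmul c x ?_ hxF)
    rintro rfl
    exact hx' (by rw [← hc, zero_smul])
  have hUo : IsOpen U := by
    rw [isOpen_proj_iff]
    simp only [hU]
    exact hF.isOpen_compl.preimage continuous_subtype_val
  have hUy : ∀ m ∈ projOrbit N S v, m ∈ U → m = Projectivization.mk ℝ y hy := by
    rintro _ ⟨w, hw, h0, rfl⟩ hmU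
    rw [hU] at hmU
    have h := (horb w hw).resolve_left hmU
    simp only [h]
  rw [accPt_iff_nhds] at hacc
  by_cases hqy : Projectivization.mk ℝ q hq = Projectivization.mk ℝ y hy
  · obtain ⟨m, ⟨hmU, hm⟩, hne⟩ := hacc U (hUo.mem_nhds ((hU q hq).2 hqF))
    exact hne ((hUy m hm hmU).trans hqy.symm)
  · obtain ⟨m, ⟨hmU, hm⟩, -⟩ := hacc (U ∩ {m | m ≠ Projectivization.mk ℝ y hy})
      ((hUo.inter (isOpen_ne_proj _)).mem_nhds ⟨(hU q hq).2 hqF, hqy⟩)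
    exact hmU.2 (hUy m hm hmU.1)

theorem ne_zero_of_mem_liftedLimitSet {S : Finset (Fin (N + 1))} {q : V N}
    (h : q ∈ liftedLimitSet N S) : q ≠ 0 :=
  h.2.1

theorem notMem_liftedLimitSet_empty (q : V N) : q ∉ liftedLimitSet N ∅ := by
  rintro ⟨-, hq, v, hv, hacc⟩
  exact mem_of_accPt hacc isClosed_empty (fun _ _ _ h => h) (ne_zero_of_mem_hypCone hv)
    fun w hw => Or.inr (WS_empty_apply hw v)

theorem form_nonneg_of_mem_liftedLimitSet (hN : 2 ≤ N) {S : Finset (Fin (N + 1))} {q : V N}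
    (h : q ∈ liftedLimitSet N S) : 0 ≤ form N q q := by
  obtain ⟨-, hq, v, hv, hacc⟩ := h
  refine mem_of_accPt (F := {x | 0 ≤ form N x x}) hacc
    (isClosed_le continuous_const continuous_form_self) (fun c x _ hx => ?_)
    (ne_zero_of_mem_hypCone hv) fun w hw => Or.inl ?_
  · have hx : 0 ≤ form N x x := hx
    change 0 ≤ form N (c • x) (c • x)
    simp only [map_smul, LinearMap.smul_apply, smul_eq_mul, ← mul_assoc]
    exact mul_nonneg (mul_self_nonneg c) hx
  · exact (mem_hypCone.1 (WS_mem_hypCone hN hw hv)).1.le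

/-- A point with negative `i`-th coordinate is nonnegative on `S`, so every orbit point is reached
from it by ascending steps. Each one other than the point itself has a negative coordinate in `S`,
hence a positive `i`-th one. -/
theorem exists_exceptional_orbit_point (hN : 2 ≤ N) {S : Finset (Fin (N + 1))}
    {i : Fin (N + 1)} (hi : i ∉ S) {v : V N} (hv : v ∈ hypCone N) :
    ∃ y : V N, y ≠ 0 ∧ ∀ w ∈ WS N S, 0 ≤ w v i ∨ w v = y := by
  by_cases hex : ∃ g ∈ WS N S, g v i < 0
  · obtain ⟨g, hg, hgi⟩ := hex
    have hgv := WS_mem_hypCone hN hg hv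
    have hpair : g v ∈ pairCone N :=
      closedTitsCone_subset_pairCone hN (subset_closure (hypCone_subset_titsCone hN hgv))
    refine ⟨g v, ne_zero_of_mem_hypCone hgv, fun w hw => ?_⟩
    have hB : ({g v} : Set (V N)) ⊆ pairCone N := by simpa using hpair
    have hreach : Reach S {g v} ((w * g⁻¹) (g v)) := by
      refine (Reach.base (Set.mem_singleton (g v))).WS hN hB ?_ (mul_mem hw (inv_mem hg))
      rintro _ rfl s hs
      exact (pos_of_neg_of_mem_pairCone hpair (fun h : s = i => hi (h ▸ hs)) hgi).le
    rw [LinearEquiv.mul_apply, inv_apply_apply] at hreach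
    rcases hreach.mem_or_neg hN with h | ⟨s, hs, hneg⟩
    · exact Or.inr h
    · exact Or.inl (pos_of_neg_of_mem_pairCone (hreach.mem_pairCone hN hB)
        (fun h : i = s => hi (h ▸ hs)) hneg).le
  · push Not at hex
    exact ⟨v, ne_zero_of_mem_hypCone hv, fun w hw => Or.inl (hex w hw)⟩

theorem apply_nonneg_of_mem_liftedLimitSet (hN : 2 ≤ N) {S : Finset (Fin (N + 1))} {q : V N}
    (h : q ∈ liftedLimitSet N S) {w : V N ≃ₗ[ℝ] V N} (hw : w ∈ WS N S) {i : Fin (N + 1)}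
    (hi : i ∉ S) : 0 ≤ w q i := by
  obtain ⟨hqT, hq, v, hv, hacc⟩ := h
  obtain ⟨y, hy, hexc⟩ := exists_exceptional_orbit_point hN hi hv
  have hmem : 0 ≤ w q i * ∑ k, q k := by
    -- The factor `∑ k, x k` makes the condition invariant under negative scalars; it is positive on
    -- the orbit and at `q`.
    refine mem_of_accPt (F := {x | 0 ≤ w x i * ∑ k, x k}) hacc ?_ (fun c x _ hx => ?_)
      (y := w⁻¹ y) (fun h => hy ?_) fun g hg => ?_
    · exact isClosed_le continuous_const
        (((continuous_apply i).comp (continuous_equiv w)).mul continuous_sum)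
    · have hx : 0 ≤ w x i * ∑ k, x k := hx
      change 0 ≤ w (c • x) i * ∑ k, (c • x) k
      simp only [map_smul, Pi.smul_apply, smul_eq_mul, ← Finset.mul_sum]
      nlinarith [mul_nonneg (mul_self_nonneg c) hx]
    · rw [← apply_inv_apply w y, h, map_zero]
    · rcases hexc (w * g) (mul_mem hw hg) with h | h
      · exact Or.inl (mul_nonneg h (mem_hypCone.1 (WS_mem_hypCone hN hg hv)).2.le)
      · right
        rw [← h, LinearEquiv.mul_apply, inv_apply_apply]
  have := sum_pos_of_mem_pairCone hN (closedTitsCone_subset_pairCone hN hqT) hq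
  exact nonneg_of_mul_nonneg_left hmem this

theorem mem_closedTitsCone_of_form_nonneg (hN : 2 ≤ N) {q : V N} (hq : 0 ≤ form N q q)
    (hs : 0 < ∑ k, q k) : q ∈ closedTitsCone N :=
  closure_mono (hypCone_subset_titsCone hN) (mem_closure_hypCone hq hs)

/-- On the slice of coordinate sum one, a small pairing of two vectors of nonnegative norm forces
them to be close. -/
theorem sum_sub_sq_le {y q : V N} (hy : 0 ≤ form N y y) (hys : ∑ k, y k = 1)
    (hq : 0 ≤ form N q q) (hqs : ∑ k, q k = 1) :
    ((N : ℝ) - 1) * ∑ k, (y k - q k) ^ 2 ≤ 2 * form N y q := by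
  rw [form_apply, hys] at hy
  rw [form_apply, hqs] at hq
  rw [form_apply, hys, hqs]
  have : ∑ k, (y k - q k) ^ 2
      = ∑ k, y k * y k - 2 * ∑ k, y k * q k + ∑ k, q k * q k := by
    rw [Finset.mul_sum, ← Finset.sum_sub_distrib, ← Finset.sum_add_distrib]
    exact Finset.sum_congr rfl fun k _ => by ring
  rw [this]
  linarith

/-- The orbit points `(g n)⁻¹ u` pair with `q` to twice the coordinate sum of `g n q`, which tends
to zero; normalised to coordinate sum one they converge to the multiple of `q` on that slice, by
`sum_sub_sq_le`. -/
theorem mem_liftedLimitSet_of_tendsto (hN : 2 ≤ N) {S : Finset (Fin (N + 1))} {q : V N}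
    (hq : form N q q = 0) (hs : 0 < ∑ k, q k) {g : ℕ → V N ≃ₗ[ℝ] V N}
    (hg : ∀ n, g n ∈ WS N S) (h : Tendsto (fun n => g n q) atTop (𝓝 0)) :
    q ∈ liftedLimitSet N S := by
  have hq0 : q ≠ 0 := by
    rintro rfl
    simp at hs
  refine ⟨mem_closedTitsCone_of_form_nonneg hN hq.ge hs, hq0, uVec N, uVec_mem_hypCone, ?_⟩
  have hc := pos_sub_one hN
  obtain ⟨y, hy⟩ : ∃ y : ℕ → V N, ∀ n, y n = (g n)⁻¹ (uVec N) := ⟨_, fun _ => rfl⟩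
  have hyH : ∀ n, y n ∈ hypCone N := fun n => by
    rw [hy]
    exact WS_mem_hypCone hN (inv_mem (hg n)) uVec_mem_hypCone
  have hy1 : ∀ n, 1 ≤ ∑ k, y n k := fun n => by
    rw [hy]
    exact sum_ge_one_of_WS hN (inv_mem (hg n))
  obtain ⟨s, hsq⟩ : ∃ s, s = ∑ k, q k := ⟨_, rfl⟩
  rw [← hsq] at hs
  obtain ⟨t, ht⟩ : ∃ t : ℕ → ℝ, ∀ n, t n = ∑ k, y n k := ⟨_, fun _ => rfl⟩
  have ht1 : ∀ n, 1 ≤ t n := fun n => ht n ▸ hy1 n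
  have hnorm : ∀ {x : V N} {c : ℝ}, c ≠ 0 → c = ∑ k, x k → ∑ k, (c⁻¹ • x) k = 1 := by
    intro x c hc hx
    simp only [Pi.smul_apply, smul_eq_mul, ← Finset.mul_sum, ← hx]
    exact inv_mul_cancel₀ hc
  have hle : ∀ n k, |((t n)⁻¹ • y n) k - (s⁻¹ • q) k|
      ≤ √(4 * |∑ k, g n q k| / (s * ((N : ℝ) - 1))) := by
    intro n k
    have htn : 0 < t n := by linarith [ht1 n]
    refine Real.abs_le_sqrt ?_
    have h1 := sum_sub_sq_le (y := (t n)⁻¹ • y n) (q := s⁻¹ • q) ?_ (hnorm htn.ne' (ht n)) ?_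
      (hnorm hs.ne' hsq)
    · have h2 : form N ((t n)⁻¹ • y n) (s⁻¹ • q) = (t n)⁻¹ * (s⁻¹ * (2 * ∑ k, g n q k)) := by
        simp only [map_smul, LinearMap.smul_apply, smul_eq_mul]
        rw [hy, form_inv_apply hN (hg n), form_comm, form_uVec]
        ring
      rw [h2] at h1
      have h3 : (((t n)⁻¹ • y n) k - (s⁻¹ • q) k) ^ 2
          ≤ ∑ k, (((t n)⁻¹ • y n) k - (s⁻¹ • q) k) ^ 2 :=
        Finset.single_le_sum (f := fun k => (((t n)⁻¹ • y n) k - (s⁻¹ • q) k) ^ 2)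
          (fun k _ => sq_nonneg _) (Finset.mem_univ k)
      rw [le_div_iff₀ (by positivity)]
      have h4 : (t n)⁻¹ * ∑ k, g n q k ≤ |∑ k, g n q k| := by
        refine (mul_le_mul_of_nonneg_left (le_abs_self _) (by positivity)).trans ?_
        exact mul_le_of_le_one_left (abs_nonneg _) (inv_le_one_of_one_le₀ (ht1 n))
      have h5 := mul_le_mul_of_nonneg_left h3 hc.le
      have h6 : s * (2 * ((t n)⁻¹ * (s⁻¹ * (2 * ∑ k, g n q k))))
          = 4 * ((t n)⁻¹ * ∑ k, g n q k) := by
        field_simp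
        ring
      have h7 := mul_le_mul_of_nonneg_left (h5.trans h1) hs.le
      rw [h6] at h7
      linarith
    · simp only [map_smul, LinearMap.smul_apply, smul_eq_mul]
      have := (mem_hypCone.1 (hyH n)).1
      positivity
    · simp only [map_smul, LinearMap.smul_apply, smul_eq_mul, hq, mul_zero, le_refl]
  have hbound : Tendsto (fun n => √(4 * |∑ k, g n q k| / (s * ((N : ℝ) - 1)))) atTop (𝓝 0) := by
    have hcont : Continuous fun x : V N => √(4 * |∑ k, x k| / (s * ((N : ℝ) - 1))) := by fun_prop
    have h0 := (hcont.tendsto 0).comp h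
    simp only [Pi.zero_apply, Finset.sum_const_zero, abs_zero, mul_zero, zero_div,
      Real.sqrt_zero] at h0
    exact h0
  have htend : Tendsto (fun n => (t n)⁻¹ • y n) atTop (𝓝 (s⁻¹ • q)) := by
    refine tendsto_pi_nhds.2 fun k => tendsto_iff_dist_tendsto_zero.2 ?_
    refine squeeze_zero (fun _ => dist_nonneg) (fun n => ?_) hbound
    rw [Real.dist_eq]
    exact hle n k
  have hyt : ∀ n, (t n)⁻¹ • y n ≠ 0 := fun n =>
    smul_ne_zero (inv_ne_zero (by linarith [ht1 n])) (ne_zero_of_mem_hypCone (hyH n))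
  have hqs : s⁻¹ • q ≠ 0 := smul_ne_zero (inv_ne_zero hs.ne') hq0
  have htend' : Tendsto (fun n => Projectivization.mk ℝ ((t n)⁻¹ • y n) (hyt n)) atTop
      (𝓝 (Projectivization.mk ℝ (s⁻¹ • q) hqs)) :=
    (continuous_mk.tendsto (⟨s⁻¹ • q, hqs⟩ : {v : V N // v ≠ 0})).comp
      (tendsto_subtype_rng.2 htend :
        Tendsto (fun n => (⟨(t n)⁻¹ • y n, hyt n⟩ : {v : V N // v ≠ 0})) atTop _)
  have hmkq : Projectivization.mk ℝ (s⁻¹ • q) hqs = Projectivization.mk ℝ q hq0 :=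
    (Projectivization.mk_eq_mk_iff' _ _ _ _ _).2 ⟨s⁻¹, rfl⟩
  have hmky : ∀ n, Projectivization.mk ℝ ((t n)⁻¹ • y n) (hyt n)
      = Projectivization.mk ℝ (y n) (ne_zero_of_mem_hypCone (hyH n)) := fun n =>
    (Projectivization.mk_eq_mk_iff' _ _ _ _ _).2 ⟨(t n)⁻¹, rfl⟩
  rw [hmkq] at htend'
  rw [accPt_iff_nhds]
  intro U hU
  obtain ⟨n, hn⟩ := (htend'.eventually hU).exists
  rw [hmky] at hn
  refine ⟨_, ⟨hn, (g n)⁻¹, inv_mem (hg n), ?_, ?_⟩, fun heq => ?_⟩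
  · rw [← hy]
    exact ne_zero_of_mem_hypCone (hyH n)
  · simp only [hy]
  -- Orbit points have positive norm while `q` is isotropic, so their classes differ.
  · obtain ⟨c, hc⟩ := (Projectivization.mk_eq_mk_iff' _ _ _ _ _).1 heq
    have h := (mem_hypCone.1 (hyH n)).1
    rw [← hc] at h
    simp [hq] at h

/-! ### The transient part of a vector -/

theorem iterate_descend_mem_closedTitsCone {x : V N} (hx : x ∈ closedTitsCone N) (n : ℕ) :
    descend^[n] x ∈ closedTitsCone N := by
  obtain ⟨w, hw, h⟩ := iterate_descend_eq x n
  rw [h]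
  exact apply_mem_closedTitsCone hw hx

theorem negIndex_eq {x : V N} (hx : x ∈ pairCone N) {i : Fin (N + 1)} (hi : x i < 0) :
    negIndex x = i :=
  eq_of_neg_of_neg hx (negIndex_spec ⟨i, hi⟩) hi

/-- Descend with the first vector and carry the second one along. -/
noncomputable def descendPair (z : V N × V N) : V N × V N :=
  (descend z.1, sigma N (negIndex z.1) z.2)

/-- The descent of `x` converges to a vector which is eventually the image of `d`. -/
def IsTransientPart (x d : V N) : Prop :=
  ∃ L : V N, Tendsto (fun n => descend^[n] x) atTop (𝓝 L) ∧
    ∀ᶠ n in atTop, (descendPair^[n] (x, d)).2 = L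

theorem descendPair_iterate_injective (n : ℕ) {x d d' : V N}
    (h : (descendPair^[n] (x, d)).2 = (descendPair^[n] (x, d')).2) : d = d' := by
  induction n generalizing x d d' with
  | zero => exact h
  | succ n ih => exact (sigma N (negIndex x)).injective (ih h)

theorem IsTransientPart.unique {x d d' : V N} (h : IsTransientPart x d)
    (h' : IsTransientPart x d') : d = d' := by
  obtain ⟨L, hL, hd⟩ := h
  obtain ⟨L', hL', hd'⟩ := h'
  obtain rfl := tendsto_nhds_unique hL hL'
  obtain ⟨n, hn, hn'⟩ := (hd.and hd').exists
  exact descendPair_iterate_injective n (hn.trans hn'.symm)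

theorem isTransientPart_descend_iff {x d : V N} :
    IsTransientPart (descend x) (sigma N (negIndex x) d) ↔ IsTransientPart x d := by
  refine exists_congr fun L => and_congr ?_ ?_
  · exact tendsto_add_atTop_iff_nat (f := fun n => descend^[n] x) 1
  · conv_rhs => rw [← map_add_atTop_eq_nat 1, eventually_map]
    rfl

/-- Outside the Tits cone one coordinate is negative and all others are positive. Reflecting at the
former is a descent step; reflecting at any other is the inverse of one. -/
theorem IsTransientPart.sigma (hN : 2 ≤ N) {x d : V N} (hx : x ∈ closedTitsCone N)
    (hxT : x ∉ titsCone N) (h : IsTransientPart x d) (i : Fin (N + 1)) :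
    IsTransientPart (sigma N i x) (sigma N i d) := by
  have hpair := closedTitsCone_subset_pairCone hN hx
  rcases lt_trichotomy (x i) 0 with hneg | h0 | hpos
  · rw [← isTransientPart_descend_iff, descend, negIndex_eq hpair hneg] at h
    exact h
  · obtain ⟨j, hj⟩ := exists_neg_of_notMem_titsCone hxT
    have := pos_of_neg_of_mem_pairCone hpair (j := i) (by rintro rfl; exact hj.ne h0) hj
    exact absurd h0 this.ne'
  · have hneg : Wehler.sigma N i x i < 0 := by
      rw [sigma_apply_self hN]
      linarith
    have hpair' := closedTitsCone_subset_pairCone hN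
      (apply_mem_closedTitsCone (sigma_mem_W i) hx)
    rw [← isTransientPart_descend_iff, descend, negIndex_eq hpair' hneg]
    simpa only [sigma_sigma] using h

theorem IsTransientPart.WS (hN : 2 ≤ N) {x d : V N} (hx : x ∈ closedTitsCone N)
    (hxT : x ∉ titsCone N) (h : IsTransientPart x d) {S : Finset (Fin (N + 1))}
    {w : V N ≃ₗ[ℝ] V N} (hw : w ∈ WS N S) : IsTransientPart (w x) (w d) := by
  induction hw using WS_induction with
  | one => exact h
  | mul i hi w hw ih =>
    exact ih.sigma hN (apply_mem_closedTitsCone (WS_le_W S hw) hx)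
      (fun hT => hxT ((apply_mem_titsCone_iff (WS_le_W S hw)).1 hT)) i

theorem openFace_apply_nonneg {S : Finset (Fin (N + 1))} {x : V N} (hx : x ∈ openFace N S)
    (i : Fin (N + 1)) : 0 ≤ x i :=
  mem_closedChamber.1 (openFace_subset_closedChamber S hx) i

theorem openFace_apply_eq_zero {S T : Finset (Fin (N + 1))} (h : Disjoint S T) {x : V N}
    (hx : x ∈ openFace N S) {i : Fin (N + 1)} (hi : i ∈ T) : x i = 0 :=
  (mem_openFace.1 hx).2 i (Finset.disjoint_right.1 h hi)

/-- Off `S` both summands stay nonnegative, so the descent uses letters of `S` only. These fix `qd`,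
and the descent acts on `qr` alone. -/
theorem transient_recurrent (hN : 2 ≤ N) {Sd S : Finset (Fin (N + 1))} (hdis : Disjoint Sd S)
    {qd qr : V N} (hqd : qd ∈ openFace N Sd) (hqr : qr ∈ liftedLimitSet N S)
    (hx : qd + qr ∈ closedTitsCone N) (hxT : qd + qr ∉ titsCone N) :
    3 ≤ S.card ∧ IsTransientPart (qd + qr) qd ∧
      ∃ g : ℕ → V N ≃ₗ[ℝ] V N, (∀ n, g n ∈ WS N S) ∧
        Tendsto (fun n => g n qr) atTop (𝓝 0) := by
  have hletter : ∀ n, ∀ g ∈ WS N S, descend^[n] (qd + qr) = qd + g qr →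
      negIndex (descend^[n] (qd + qr)) ∈ S := by
    intro n g hg h
    have hneg := negIndex_spec
      (exists_neg_of_notMem_titsCone (iterate_descend_notMem hxT n))
    by_contra hi
    rw [h] at hneg hi
    have h1 := openFace_apply_nonneg hqd (negIndex (qd + g qr))
    have h2 := apply_nonneg_of_mem_liftedLimitSet hN hqr hg hi
    rw [Pi.add_apply] at hneg
    linarith
  have hiter : ∀ n, ∃ g ∈ WS N S, descend^[n] (qd + qr) = qd + g qr ∧
      descendPair^[n] (qd + qr, qd) = (descend^[n] (qd + qr), qd) := by
    intro n
    induction n with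
    | zero => exact ⟨1, one_mem _, rfl, rfl⟩
    | succ n ih =>
      obtain ⟨g, hg, h, h'⟩ := ih
      have hi := hletter n g hg h
      have hfix : sigma N (negIndex (descend^[n] (qd + qr))) qd = qd :=
        sigma_eq_self hN (openFace_apply_eq_zero hdis hqd hi)
      refine ⟨_, mul_mem (sigma_mem_WS hi) hg, ?_, ?_⟩
      · rw [LinearEquiv.mul_apply, Function.iterate_succ_apply', descend]
        nth_rewrite 2 [h]
        rw [map_add, hfix]
      · rw [Function.iterate_succ_apply', h', descendPair, Function.iterate_succ_apply']
        simp only [hfix]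
  choose g hg hdesc hpair using hiter
  obtain ⟨L, S', hS', hL, hLS', hS'ex, -⟩ := iterate_descend_limit hN hxT fun n =>
    sum_nonneg_of_mem_pairCone hN
      (closedTitsCone_subset_pairCone hN (iterate_descend_mem_closedTitsCone hx n))
  have hsub : S' ⊆ S := by
    intro s hs
    obtain ⟨n, rfl⟩ := hS'ex s hs
    exact hletter n (g n) (hg n) (hdesc n)
  have hgL : Tendsto (fun n => g n qr) atTop (𝓝 (L - qd)) := by
    refine (hL.sub_const qd).congr fun n => ?_
    rw [hdesc, add_sub_cancel_left]
  have hform : form N (L - qd) (L - qd) = form N qr qr := by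
    refine tendsto_nhds_unique ((continuous_form_self.tendsto _).comp hgL)
      (tendsto_const_nhds.congr fun n => ?_)
    rw [Function.comp_apply, form_WS hN (hg n)]
  -- `L - qd` inherits the nonnegative norm of `qr` and vanishes on at least three coordinates.
  have hL0 : L - qd = 0 := by
    refine eq_zero_of_form_nonneg (S := S'ᶜ) ?_ (fun k hk => ?_)
      (hform ▸ form_nonneg_of_mem_liftedLimitSet hN hqr)
    · rw [Finset.card_compl, Fintype.card_fin]
      omega
    · have hk' : k ∈ S' := by simpa using hk
      rw [Pi.sub_apply, hLS' k hk', openFace_apply_eq_zero hdis hqd (hsub hk'), sub_zero]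
  rw [hL0] at hgL
  rw [sub_eq_zero.1 hL0] at hL
  refine ⟨hS'.trans (Finset.card_le_card hsub), ⟨qd, hL, ?_⟩, g, hg, hgL⟩
  exact Eventually.of_forall fun n => by rw [hpair]

/-- For interior `q`, some `q - t u` with `t > 0` stays in the closed cone. The coordinate sum of `g
n q` is then at least `t` times that of `g n u`, which is at least one. -/
theorem mem_frontier_of_tendsto_zero (hN : 2 ≤ N) {S : Finset (Fin (N + 1))} {q : V N}
    (hq : q ∈ closedTitsCone N) {g : ℕ → V N ≃ₗ[ℝ] V N} (hg : ∀ n, g n ∈ WS N S)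
    (h : Tendsto (fun n => g n q) atTop (𝓝 0)) : q ∈ frontier (closedTitsCone N) := by
  refine ⟨subset_closure hq, fun hint => ?_⟩
  obtain ⟨t, ht0, ht⟩ := exists_sub_smul_mem_of_mem_interior hint
  have hge : ∀ n, t ≤ ∑ k, g n q k := by
    intro n
    have h1 := sum_nonneg_of_mem_pairCone hN (closedTitsCone_subset_pairCone hN
      (apply_mem_closedTitsCone (WS_le_W S (hg n)) ht))
    simp only [map_sub, map_smul, Pi.sub_apply, Pi.smul_apply, smul_eq_mul,
      Finset.sum_sub_distrib, ← Finset.mul_sum] at h1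
    nlinarith [sum_ge_one_of_WS hN (hg n)]
  have hlim : Tendsto (fun n => ∑ k, g n q k) atTop (𝓝 0) := by
    have h0 := (continuous_sum.tendsto (0 : V N)).comp h
    simp only [Pi.zero_apply, Finset.sum_const_zero] at h0
    exact h0
  exact absurd (ge_of_tendsto' hlim hge) (not_le.2 ht0)

/-! ### Presentations -/

/-- The last ascending step leading to `d + q` leaves a negative coordinate, which must lie in `S`;
undoing it fixes `d` and replaces `q` by another `W_S`-image. -/
theorem exists_apply_mem_closedChamber (hN : 2 ≤ N) {S : Finset (Fin (N + 1))} {d q : V N}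
    (hdS : ∀ s ∈ S, d s = 0) (hd : ∀ i, 0 ≤ d i)
    (hq : ∀ w ∈ WS N S, ∀ i ∉ S, 0 ≤ w q i) (hT : d + q ∈ titsCone N) :
    ∃ g ∈ WS N S, d + g q ∈ closedChamber N := by
  rw [mem_titsCone_iff_reach hN] at hT
  obtain ⟨x, hx⟩ : ∃ x, x = d + q := ⟨_, rfl⟩
  rw [← hx] at hT
  induction hT generalizing q with
  | base hxc => exact ⟨1, one_mem _, hx ▸ hxc⟩
  | @step y s _ hpos _ ih =>
    have hneg : d s + q s < 0 := by
      rw [← Pi.add_apply, ← hx, sigma_apply_self hN]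
      linarith
    have hs : s ∈ S := by
      by_contra hs
      have h : 0 ≤ q s := hq 1 (one_mem _) s hs
      linarith [hd s]
    obtain ⟨g, hg, hgc⟩ := ih (q := sigma N s q)
      (fun w hw i hi => hq (w * sigma N s) (mul_mem hw (sigma_mem_WS hs)) i hi) (by
        rw [← sigma_sigma s y, hx, map_add, sigma_eq_self hN (hdS s hs)])
    exact ⟨g * sigma N s, mul_mem hg (sigma_mem_WS hs), hgc⟩

theorem IsPresentation.inv_apply {p : V N} {w : V N ≃ₗ[ℝ] V N} {Sd Sr : Finset (Fin (N + 1))}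
    {qd qr : V N} (h : IsPresentation N p w Sd Sr qd qr) : w⁻¹ p = qd + qr := by
  rw [h.2.2.2.2, ← map_add, inv_apply_apply]

theorem IsPresentation.eq_apply {p : V N} {w : V N ≃ₗ[ℝ] V N} {Sd Sr : Finset (Fin (N + 1))}
    {qd qr : V N} (h : IsPresentation N p w Sd Sr qd qr) : p = w (qd + qr) := by
  rw [h.2.2.2.2, map_add]

theorem card_le_of_mem_openFace_of_mem_frontier (hN : 2 ≤ N) {S : Finset (Fin (N + 1))} {x : V N}
    (hx : x ∈ openFace N S) (hf : x ∈ frontier (closedTitsCone N)) : S.card ≤ N - 1 := by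
  by_contra h
  exact hf.2 (openFace_subset_interior hN (by omega) hx)

/-- The recurrent part is absorbed into a face of the chamber. -/
theorem IsPresentation.exists_of_mem_titsCone (hN : 2 ≤ N) {p : V N} {w : V N ≃ₗ[ℝ] V N}
    {Sd Sr : Finset (Fin (N + 1))} {qd qr : V N} (h : IsPresentation N p w Sd Sr qd qr)
    (hqr : qr ∈ liftedLimitSet N Sr) (hp : p ∈ frontier (closedTitsCone N))
    (hpT : p ∈ titsCone N) :
    ∃ (w' : V N ≃ₗ[ℝ] V N) (Sd' : Finset (Fin (N + 1))) (qd' : V N),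
      IsPresentation N p w' Sd' ∅ qd' 0 ∧ Sd ⊆ Sd' ∧ Sd'.card = N - 1 := by
  have hpeq := h.eq_apply
  obtain ⟨hw, hdis, hqd, -, -⟩ := h
  rw [hpeq, apply_mem_titsCone_iff hw] at hpT
  rw [hpeq, apply_mem_frontier_iff hw] at hp
  have hoff : ∀ g ∈ WS N Sr, ∀ i ∉ Sr, 0 ≤ g qr i := fun g hg i hi =>
    apply_nonneg_of_mem_liftedLimitSet hN hqr hg hi
  have hqdS : ∀ s ∈ Sr, qd s = 0 := fun s hs => openFace_apply_eq_zero hdis hqd hs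
  obtain ⟨g, hg, hgc⟩ := exists_apply_mem_closedChamber hN hqdS (openFace_apply_nonneg hqd)
    hoff hpT
  obtain ⟨S, hS⟩ := exists_mem_openFace hgc
  have hgW := WS_le_W Sr hg
  have hgx : g (qd + qr) = qd + g qr := by
    rw [map_add, WS_apply_eq_self hN hg hqdS]
  have hsub : Sd ⊆ S := by
    intro s hs
    by_contra hsS
    have h0 := (mem_openFace.1 hS).2 s hsS
    have h1 := (mem_openFace.1 hqd).1 s hs
    have h2 := hoff g hg s (Finset.disjoint_left.1 hdis hs)
    rw [Pi.add_apply] at h0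
    linarith
  have hcard : S.card ≤ N - 1 := by
    refine card_le_of_mem_openFace_of_mem_frontier hN hS ?_
    rw [← hgx]
    exact apply_mem_frontier hgW hp
  refine ⟨w * g⁻¹, S, qd + g qr, ⟨mul_mem hw (inv_mem hgW), Finset.disjoint_empty_right S, hS,
    Or.inr ⟨rfl, rfl⟩, ?_⟩, hsub, ?_⟩
  · rw [map_zero, add_zero, LinearEquiv.mul_apply, ← hgx, inv_apply_apply, hpeq]
  -- On a smaller face `g qr`, being supported in `S` and of nonnegative norm, would vanish.
  · refine hcard.eq_of_not_lt fun hlt => ne_zero_of_mem_liftedLimitSet hqr ?_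
    refine (map_eq_zero_iff g g.injective).1 (eq_zero_of_form_nonneg hlt (fun k hk => ?_) ?_)
    · have h0 := (mem_openFace.1 hS).2 k hk
      rw [Pi.add_apply, (mem_openFace.1 hqd).2 k fun h => hk (hsub h), zero_add] at h0
      exact h0
    · rw [form_WS hN hg]
      exact form_nonneg_of_mem_liftedLimitSet hN hqr

theorem IsPresentation.transient_recurrent (hN : 2 ≤ N) {p : V N} {w : V N ≃ₗ[ℝ] V N}
    {Sd Sr : Finset (Fin (N + 1))} {qd qr : V N} (h : IsPresentation N p w Sd Sr qd qr)
    (hp : p ∈ closedTitsCone N) (hpT : p ∉ titsCone N) :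
    3 ≤ Sr.card ∧ IsTransientPart p (w qd) ∧ w qr ∈ frontier (closedTitsCone N) := by
  have hpeq := h.eq_apply
  have hx : qd + qr ∈ closedTitsCone N :=
    h.inv_apply ▸ apply_mem_closedTitsCone (inv_mem h.1) hp
  obtain ⟨hw, hdis, hqd, hqr, -⟩ := h
  rw [hpeq, apply_mem_titsCone_iff hw] at hpT
  rcases hqr with hqr | ⟨-, rfl⟩
  · obtain ⟨hcard, htr, g, hg, hlim⟩ := Wehler.transient_recurrent hN hdis hqd hqr hx hpT
    rw [hpeq]
    exact ⟨hcard, htr.WS hN hx hpT hw,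
      apply_mem_frontier hw (mem_frontier_of_tendsto_zero hN hqr.1 hg hlim)⟩
  · rw [add_zero] at hpT
    exact absurd (closedChamber_subset_titsCone (openFace_subset_closedChamber Sd hqd)) hpT

theorem IsPresentation.card_le (hN : 2 ≤ N) {p : V N} {w : V N ≃ₗ[ℝ] V N}
    {Sd Sr : Finset (Fin (N + 1))} {qd qr : V N} (h : IsPresentation N p w Sd Sr qd qr)
    (hp : p ∈ frontier (closedTitsCone N)) : Sd.card ≤ N - 1 := by
  by_cases hpT : p ∈ titsCone N
  · rcases h.2.2.2.1 with hqr | ⟨-, rfl⟩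
    · obtain ⟨w', Sd', qd', -, hsub, hcard⟩ := h.exists_of_mem_titsCone hN hqr hp hpT
      exact hcard ▸ Finset.card_le_card hsub
    · refine card_le_of_mem_openFace_of_mem_frontier hN h.2.2.1 ?_
      rw [← apply_mem_frontier_iff h.1, ← add_zero qd, ← h.eq_apply]
      exact hp
  · have h3 := (h.transient_recurrent hN (frontier_subset_closedTitsCone hp) hpT).1
    have := Finset.card_le_univ (Sd ∪ Sr)
    rw [Finset.card_union_of_disjoint h.2.1, Fintype.card_fin] at this
    omega

theorem exists_presentation (hN : 2 ≤ N) {p : V N} (hp : p ∈ closedTitsCone N) :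
    ∃ (w : V N ≃ₗ[ℝ] V N) (Sd Sr : Finset (Fin (N + 1))) (qd qr : V N),
      IsPresentation N p w Sd Sr qd qr := by
  by_cases hpT : p ∈ titsCone N
  · obtain ⟨w, hw, x, hx, rfl⟩ := hpT
    obtain ⟨S, hS⟩ := exists_mem_openFace hx
    exact ⟨w, S, ∅, x, 0, hw, Finset.disjoint_empty_right S, hS, Or.inr ⟨rfl, rfl⟩, by simp⟩
  have hpair : ∀ n, descend^[n] p ∈ pairCone N := fun n =>
    closedTitsCone_subset_pairCone hN (iterate_descend_mem_closedTitsCone hp n)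
  obtain ⟨L, S, hS, hL, hLS, -, hev⟩ := iterate_descend_limit hN hpT fun n =>
    sum_nonneg_of_mem_pairCone hN (hpair n)
  have hLpair : L ∈ pairCone N := isClosed_pairCone.mem_of_tendsto hL (Eventually.of_forall hpair)
  have hLchamber : L ∈ closedChamber N := by
    refine mem_closedChamber.2 fun k => ?_
    by_cases hk : k ∈ S
    · exact (hLS k hk).ge
    -- Pairing with a coordinate where `L` vanishes turns the pair sum into `L k`.
    · obtain ⟨s, hs⟩ := Finset.card_pos.1 (by omega : 0 < S.card)
      have := hLpair k s fun h => hk (h ▸ hs)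
      rwa [hLS s hs, add_zero] at this
  obtain ⟨Sd, hSd⟩ := exists_mem_openFace hLchamber
  have hdis : Disjoint Sd S := Finset.disjoint_left.2 fun s hs hs' =>
    ((mem_openFace.1 hSd).1 s hs).ne' (hLS s hs')
  obtain ⟨n₀, hn₀⟩ := eventually_atTop.1 hev
  obtain ⟨w, hw, hwp⟩ := iterate_descend_eq p n₀
  have hiter : ∀ m, ∃ g ∈ WS N S, descend^[m + n₀] p = g (descend^[n₀] p) := by
    intro m
    induction m with
    | zero => exact ⟨1, one_mem _, by rw [zero_add]; rfl⟩
    | succ m ih =>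
      obtain ⟨g, hg, h⟩ := ih
      refine ⟨sigma N (negIndex (descend^[m + n₀] p)) * g,
        mul_mem (sigma_mem_WS (hn₀ _ (Nat.le_add_left _ _))) hg, ?_⟩
      rw [LinearEquiv.mul_apply, ← h, Nat.succ_add, Function.iterate_succ_apply']
      rfl
  choose g hg hdesc using hiter
  have hlim : Tendsto (fun m => g m (descend^[n₀] p - L)) atTop (𝓝 0) := by
    have h1 : Tendsto (fun m => descend^[m + n₀] p) atTop (𝓝 L) :=
      (tendsto_add_atTop_iff_nat (f := fun n => descend^[n] p) n₀).2 hL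
    rw [← sub_self L]
    refine (h1.sub_const L).congr fun m => ?_
    rw [map_sub, WS_apply_eq_self hN (hg m) hLS, hdesc]
  -- The norm is constant along images that tend to zero.
  have hform : form N (descend^[n₀] p - L) (descend^[n₀] p - L) = 0 := by
    have h1 := (continuous_form_self.tendsto (0 : V N)).comp hlim
    rw [map_zero] at h1
    exact tendsto_nhds_unique (tendsto_const_nhds.congr fun m => by
      rw [Function.comp_apply, form_WS hN (hg m)]) h1
  have hstep : ∀ n, ∑ k, (descend^[n + 1] p) k < ∑ k, (descend^[n] p) k := by
    intro n
    have hneg := negIndex_spec (exists_neg_of_notMem_titsCone (iterate_descend_notMem hpT n))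
    rw [Function.iterate_succ_apply', descend, sum_sigma hN]
    nlinarith [mul_neg_of_pos_of_neg (pos_sub_one hN) hneg]
  -- The coordinate sums decrease strictly, so a term of the descent exceeds the limit.
  have hsum : 0 < ∑ k, (descend^[n₀] p - L) k := by
    have h1 : ∑ k, L k ≤ ∑ k, (descend^[n₀ + 1] p) k :=
      (antitone_nat_of_succ_le fun n => (hstep n).le).le_of_tendsto ((continuous_sum.tendsto L).comp hL) (n₀ + 1)
    simp only [Pi.sub_apply, Finset.sum_sub_distrib]
    linarith [hstep n₀]
  refine ⟨w⁻¹, Sd, S, L, descend^[n₀] p - L, inv_mem hw, hdis, hSd,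
    Or.inl (mem_liftedLimitSet_of_tendsto hN hform hsum hg hlim), ?_⟩
  rw [← map_add, add_sub_cancel, hwp, inv_apply_apply]

theorem exists_isMaximalPresentation (hN : 2 ≤ N) {p : V N}
    (hp : p ∈ frontier (closedTitsCone N)) :
    ∃ (w : V N ≃ₗ[ℝ] V N) (Sd Sr : Finset (Fin (N + 1))) (qd qr : V N),
      IsMaximalPresentation N p w Sd Sr qd qr := by
  have hpc := frontier_subset_closedTitsCone hp
  obtain ⟨w₀, Sd₀, Sr₀, qd₀, qr₀, h₀⟩ := exists_presentation hN hpc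
  let A : Set ℕ := {n | ∃ (w : V N ≃ₗ[ℝ] V N) (Sd Sr : Finset (Fin (N + 1))) (qd qr : V N),
    IsPresentation N p w Sd Sr qd qr ∧ Sd.card = n}
  have hbdd : BddAbove A := by
    refine ⟨N - 1, ?_⟩
    rintro _ ⟨w, Sd, Sr, qd, qr, h, rfl⟩
    exact h.card_le hN hp
  obtain ⟨w, Sd, Sr, qd, qr, h, hcard⟩ :=
    Nat.sSup_mem (s := A) ⟨_, w₀, Sd₀, Sr₀, qd₀, qr₀, h₀, rfl⟩ hbdd
  have hmax : ∀ (w' : V N ≃ₗ[ℝ] V N) (Sd' Sr' : Finset (Fin (N + 1))) (qd' qr' : V N),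
      IsPresentation N p w' Sd' Sr' qd' qr' → Sd'.card ≤ Sd.card :=
    fun w' Sd' Sr' qd' qr' h' => hcard ▸ le_csSup hbdd ⟨w', Sd', Sr', qd', qr', h', rfl⟩
  by_cases hpar : Sd.card = N - 1 → Sr = ∅
  · exact ⟨w, Sd, Sr, qd, qr, h, hmax, hpar⟩
  push Not at hpar
  obtain ⟨hSd, hSr⟩ := hpar
  -- Outside the Tits cone `S_r` has at least three elements, which leaves at most `N - 2` for
  -- `S_d`.
  have hpT : p ∈ titsCone N := by
    by_contra hpT
    have h3 := (h.transient_recurrent hN hpc hpT).1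
    have := Finset.card_le_univ (Sd ∪ Sr)
    rw [Finset.card_union_of_disjoint h.2.1, Fintype.card_fin] at this
    omega
  have hqr := h.2.2.2.1.resolve_right fun hc => hSr.ne_empty hc.1
  obtain ⟨w', Sd', qd', h', -, hcard'⟩ := h.exists_of_mem_titsCone hN hqr hp hpT
  exact ⟨w', Sd', ∅, qd', 0, h', fun w'' Sd'' Sr'' qd'' qr'' h'' => hcard' ▸ h''.card_le hN hp,
    fun _ => rfl⟩

/-- A recurrent part would yield a presentation with `N - 1` transient indices; maximality then
gives `Sd.card = N - 1`, and the parabolic clause excludes the recurrent part. -/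
theorem IsMaximalPresentation.recurrent_eq_empty (hN : 2 ≤ N) {p : V N} {w : V N ≃ₗ[ℝ] V N}
    {Sd Sr : Finset (Fin (N + 1))} {qd qr : V N} (h : IsMaximalPresentation N p w Sd Sr qd qr)
    (hp : p ∈ frontier (closedTitsCone N)) (hpT : p ∈ titsCone N) : Sr = ∅ ∧ qr = 0 := by
  refine h.1.2.2.2.1.resolve_left fun hqr => ?_
  obtain ⟨w', Sd', qd', h', -, hcard⟩ := h.1.exists_of_mem_titsCone hN hqr hp hpT
  have hle := h.2.1 w' Sd' ∅ qd' 0 h'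
  have hSr := h.2.2 (le_antisymm (h.1.card_le hN hp) (hcard ▸ hle))
  rw [hSr] at hqr
  exact notMem_liftedLimitSet_empty qr hqr

theorem IsMaximalPresentation.transient_eq (hN : 2 ≤ N) {p : V N} {w w' : V N ≃ₗ[ℝ] V N}
    {Sd Sr Sd' Sr' : Finset (Fin (N + 1))} {qd qr qd' qr' : V N}
    (h : IsMaximalPresentation N p w Sd Sr qd qr)
    (h' : IsMaximalPresentation N p w' Sd' Sr' qd' qr')
    (hp : p ∈ frontier (closedTitsCone N)) : w qd = w' qd' := by
  by_cases hpT : p ∈ titsCone N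
  · have h1 := h.1.eq_apply
    have h2 := h'.1.eq_apply
    rw [(h.recurrent_eq_empty hN hp hpT).2, add_zero] at h1
    rw [(h'.recurrent_eq_empty hN hp hpT).2, add_zero] at h2
    exact h1.symm.trans h2
  · have hpc := frontier_subset_closedTitsCone hp
    exact (h.1.transient_recurrent hN hpc hpT).2.1.unique
      (h'.1.transient_recurrent hN hpc hpT).2.1

end Wehler

theorem theorem2p6 (N : ℕ) (hN : 2 ≤ N) (p : Wehler.V N)
    (hp : p ∈ frontier (Wehler.closedTitsCone N)) :
    (∃! d : Wehler.V N × Wehler.V N,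
      p = d.1 + d.2 ∧
      ∃ (w : Wehler.V N ≃ₗ[ℝ] Wehler.V N) (Sd Sr : Finset (Fin (N + 1))) (qd qr : Wehler.V N),
        Wehler.IsMaximalPresentation N p w Sd Sr qd qr ∧ d.1 = w qd ∧ d.2 = w qr) ∧
    (∀ (w : Wehler.V N ≃ₗ[ℝ] Wehler.V N) (Sd Sr : Finset (Fin (N + 1))) (qd qr : Wehler.V N),
      Wehler.IsMaximalPresentation N p w Sd Sr qd qr →
        w qd ∈ frontier (Wehler.closedTitsCone N) ∧
        w qr ∈ frontier (Wehler.closedTitsCone N) ∧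
        (Sr.Nonempty → 3 ≤ Sr.card) ∧
        (Sd.Nonempty → Sd.card ≤ N - 1)) := by
  constructor
  · obtain ⟨w, Sd, Sr, qd, qr, h⟩ := Wehler.exists_isMaximalPresentation hN hp
    refine ⟨(w qd, w qr), ⟨h.1.2.2.2.2, w, Sd, Sr, qd, qr, h, rfl, rfl⟩, ?_⟩
    rintro ⟨d, r⟩ ⟨hsum, w', Sd', Sr', qd', qr', h', hd, -⟩
    have hd' : d = w qd := hd.trans (h'.transient_eq hN h hp)
    have hr : p = d + r := hsum
    -- The recurrent part is determined as `p` minus the transient part.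
    refine Prod.ext hd' (add_left_cancel (a := d) ?_)
    rw [← hr, hd']
    exact h.1.2.2.2.2
  · intro w Sd Sr qd qr h
    have hcard := h.1.card_le hN hp
    have hqd := Wehler.apply_mem_frontier h.1.1
      (Wehler.openFace_subset_frontier hN hcard h.1.2.2.1)
    by_cases hpT : p ∈ Wehler.titsCone N
    · obtain ⟨hSr, hqr⟩ := h.recurrent_eq_empty hN hp hpT
      have h0 : (0 : Wehler.V N) ∈ Wehler.openFace N ∅ := Wehler.mem_openFace.2 (by simp)
      refine ⟨hqd, ?_, fun hne => absurd hSr hne.ne_empty, fun _ => hcard⟩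
      rw [hqr]
      exact Wehler.apply_mem_frontier h.1.1 (Wehler.openFace_subset_frontier hN (by simp) h0)
    · obtain ⟨h3, -, hqr⟩ := h.1.transient_recurrent hN
        (Wehler.frontier_subset_closedTitsCone hp) hpT
      exact ⟨hqd, hqr, fun _ => h3, fun _ => hcard⟩
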